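/- **Theorem ($L^\infty(H)$-stability of the $hp$-dG time stepping method).** *Setting.* Let $X,H$ be real Hilbert spaces with $X$ continuously, injectively and densely embedded in $H$, let $A:X\to X^\star$ be linear, bounded, self-adjoint ($\langle Av,w\rangle=\langle Aw,v\rangle$) and coercive ($\langle Av,v\rangle\ge\alpha\|v\|_X^2$ for some $\alpha>0$), let $f\in L^2((0,T);H)$ and $u_0\in H$. Let $0=t_0<t_1<\dots<t_M=T$, $I_i=(t_{i-1},t_i]$, $k_i=t_i-t_{i-1}$, let $r_1,\dots,r_M\ge0$ be integers, and let $X_0,\dots,X_M\subset X$ be finite-dimensional subspaces. Let $\pi_0:H\to X_0$ be the $H$-orthogonal projection, and let $P^{r}(J;V)$ denote the polynomials of degree at most $r$ on $J$ with values in $V$. For $1\le i\le M$ define $A_i:X_i\to X_i$ by $(A_iu,v)_H=\langle Au,v\rangle$ for all $v\in X_i$. The fully discrete dG solution of $u'+Au=f$, $u(0)=u_0$, is the function $U$ with $U|_{I_i}\in P^{r_i}(I_i;X_i)$ and, for $1\le i\le M$ and all $\Phi\in P^{r_i}(I_i;X_i)$, $$\int_{I_i}(U',\Phi)_H\,dt+(U_{i-1}^+-U_{i-1}^-,\Phi_{i-1}^+)_H+\int_{I_i}\langle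 AU,\Phi\rangle\,dt=\int_{I_i}(f,\Phi)_H\,dt,$$ where $U_{i-1}^\pm$ are the one-sided limits at $t_{i-1}$ and $U_0^-:=\pi_0u_0$. *Constants.* For $\lambda>0$, $1\le i\le M$ and an integer $r\ge0$ let $\psi=\psi_{\lambda,i}^{r}\in P^{r}(I_i;\mathbb R)$ be the dG approximation on $I_i$ of $\psi'+\lambda\psi=0$, $\psi(t_{i-1})=1$, i.e. $$\int_{I_i}\psi'v\,dt+\psi(t_{i-1})v(t_{i-1})+\lambda\int_{I_i}\psi v\,dt=v(t_{i-1})\qquad\text{for all }v\in P^{r}(I_i;\mathbb R),$$ let $e_{\lambda,i}^{r}(t)=e^{-\lambda(t-t_{i-1})}-\psi_{\lambda,i}^{r}(t)$, and $$C^{L^2}_{\lambda,i}(r)=\sqrt{\frac{3}{2(2r+1)+k_i\lambda}}\;\left\|\frac{e_{\lambda,i}^{r}}{e_{\lambda,i}^{r}(t_{i-1})}\right\|_{L^\infty(I_i)}+1 .$$ Let $C_i=C_i(r_i)$, where $C_i(r)$ is the maximum of $C^{L^2}_{\lambda,i}(r)$ over the eigenvalues $\lambda$ of $A_i$ (and $0$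 if $X_i=\{0\}$), and let $\gamma_m=\max_{1\le i\le m}C_i$. *Claim.* The dG solution $U$ exists and is unique, and for every $1\le m\le M$ $$\|U\|_{L^\infty((0,t_m);H)}\le\|\pi_0u_0\|_H+\gamma_m\,t_m^{1/2}\,\|f\|_{L^2((0,t_m);H)} .$$ Moreover, the constants are bounded uniformly in the time steps, the polynomial degrees and the remaining data: $$C_i\le1+2\sqrt{\frac{3}{2(2r_i+1)}}\qquad(1\le i\le M),$$ and $C_i\ge1$ if $X_i\ne\{0\}$. In particular, if $X_i\neq\{0\}$, then $C_i\to1$ as $r_i\to\infty$; and if $X_i\ne\{0\}$ for all $i\le m$, then $\gamma_m\to1$ as the degrees $(r_1,\dots,r_M)$ all tend to infinity. -/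

import Mathlib

open MeasureTheory Filter Topology
open scoped InnerProductSpace ENNReal

noncomputable section

namespace DGTime

/-- `polySpace V r` is the space `P^r(J; V)` of polynomials `p(t) = ∑_{i ≤ r} t^i v_i` of degree at
most `r` with coefficients `v_i` in the subspace `V`. A polynomial on a nondegenerate interval `J` is
identified with its unique polynomial extension to the real line. -/
def polySpace {E : Type*} [AddCommGroup E] [Module ℝ E] (V : Submodule ℝ E) (r : ℕ) :
    Submodule ℝ (ℝ → E) where
  carrier := {p | ∃ c : ℕ → E, (∀ i, c i ∈ V) ∧
    ∀ t, p t = ∑ i ∈ Finset.range (r + 1), t ^ i • c i}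
  zero_mem' := ⟨0, fun _ => V.zero_mem, fun t => by simp⟩
  add_mem' := by
    rintro p q ⟨c, hc, hp⟩ ⟨d, hd, hq⟩
    exact ⟨c + d, fun i => V.add_mem (hc i) (hd i), fun t => by
      simp [hp, hq, smul_add, Finset.sum_add_distrib]⟩
  smul_mem' := by
    rintro a p ⟨c, hc, hp⟩
    exact ⟨a • c, fun i => V.smul_mem a (hc i), fun t => by
      simp [hp, Finset.smul_sum, smul_comm a]⟩

section Abstract

variable {X H : Type*} [NormedAddCommGroup X] [InnerProductSpace ℝ X]
  [NormedAddCommGroup H] [InnerProductSpace ℝ H]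

/-- One step on `(a, b]` of the discontinuous Galerkin time stepping method of degree `r` with spatial
space `V`, incoming value `w` (the left limit of the discrete solution at `a`) and source `f`:
`U ∈ P^r((a,b]; V)` and, for all `Φ ∈ P^r((a,b]; V)`,
`∫ (U', Φ)_H + (U(a⁺) - w, Φ(a⁺))_H + ∫ ⟨A U, Φ⟩ = ∫ (f, Φ)_H`.
The embedding of `X` into `H` is `ι`. Since `U` and `Φ` are polynomials, their right limits at `a` are
their values at `a`. -/
def IsDGStep (ι : X →L[ℝ] H) (A : X →L[ℝ] StrongDual ℝ X) (V : Submodule ℝ X) (r : ℕ) (a b : ℝ)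
    (w : H) (f : ℝ → H) (U : ℝ → X) : Prop :=
  U ∈ polySpace V r ∧ ∀ Φ ∈ polySpace V r,
    (∫ s in a..b, ⟪ι (deriv U s), ι (Φ s)⟫_ℝ) + ⟪ι (U a) - w, ι (Φ a)⟫_ℝ
      + (∫ s in a..b, A (U s) (Φ s)) = ∫ s in a..b, ⟪f s, ι (Φ s)⟫_ℝ

/-- The inner product of `H` as a bilinear form on a subspace `V` of `X`. -/
def massForm (ι : X →L[ℝ] H) (V : Submodule ℝ X) : LinearMap.BilinForm ℝ V :=
  (innerₗ H).compl₁₂ (ι.toLinearMap ∘ₗ V.subtype) (ι.toLinearMap ∘ₗ V.subtype)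

@[simp] lemma massForm_apply (ι : X →L[ℝ] H) (V : Submodule ℝ X) (u v : V) :
    massForm ι V u v = ⟪ι (u : X), ι (v : X)⟫_ℝ := rfl

lemma massForm_nondegenerate {ι : X →L[ℝ] H} (hι : Function.Injective ι) (V : Submodule ℝ X) :
    (massForm ι V).Nondegenerate := by
  have key : ∀ u : V, massForm ι V u u = 0 → u = 0 := fun u hu => by
    rw [massForm_apply, inner_self_eq_zero] at hu
    exact Subtype.ext (hι (by simpa using hu))
  exact ⟨fun u hu => key u (hu u), fun u hu => key u (hu u)⟩

/-- The discretization `A_V : X → V` of `A`, given by `(A_V u, v)_H = ⟨A u, v⟩` for all `v ∈ V`. -/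
def discreteOp (ι : X →L[ℝ] H) (hι : Function.Injective ι) (A : X →L[ℝ] StrongDual ℝ X)
    (V : Submodule ℝ X) [FiniteDimensional ℝ V] : X →ₗ[ℝ] V where
  toFun u := ((massForm ι V).toDual (massForm_nondegenerate hι V)).symm
    ((A u).toLinearMap ∘ₗ V.subtype)
  map_add' u v := by
    rw [← map_add]; congr 1; ext; simp
  map_smul' c u := by
    rw [RingHom.id_apply, ← map_smul]; congr 1; ext; simp

lemma inner_discreteOp (ι : X →L[ℝ] H) (hι : Function.Injective ι) (A : X →L[ℝ] StrongDual ℝ X)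
    (V : Submodule ℝ X) [FiniteDimensional ℝ V] (u : X) (v : V) :
    ⟪ι (discreteOp ι hι A V u : X), ι (v : X)⟫_ℝ = A u v := by
  rw [← massForm_apply]
  simp [discreteOp, LinearMap.BilinForm.apply_toDual_symm_apply]

/-- The restriction of `A_V` to an endomorphism of `V`. -/
def discreteEnd (ι : X →L[ℝ] H) (hι : Function.Injective ι) (A : X →L[ℝ] StrongDual ℝ X)
    (V : Submodule ℝ X) [FiniteDimensional ℝ V] : Module.End ℝ V :=
  discreteOp ι hι A V ∘ₗ V.subtype

/-- The `H`-orthogonal projection of `H` onto the finite-dimensional subspace `V` of `X` (viewed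
inside `H` through `ι`). -/
def spaceProj (ι : X →L[ℝ] H) (V : Submodule ℝ X) [FiniteDimensional ℝ V] : H →L[ℝ] H :=
  (V.map ι.toLinearMap).starProjection

end Abstract

section Scalar

/-- The scalar operator `v ↦ lam v`, where `ℝ` is identified with its dual. -/
def scalarOp (lam : ℝ) : ℝ →L[ℝ] StrongDual ℝ ℝ :=
  lam • ContinuousLinearMap.mul ℝ ℝ

/-- `ψ` is the dG approximation of degree `r` on `(a, b]` of `ψ' + lam ψ = 0`, `ψ(a) = 1`. -/
def IsFundamentalSolution (a b lam : ℝ) (r : ℕ) (ψ : ℝ → ℝ) : Prop :=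
  IsDGStep (ContinuousLinearMap.id ℝ ℝ) (scalarOp lam) ⊤ r a b 1 0 ψ

lemma exists_polynomial_of_mem {r : ℕ} {p : ℝ → ℝ}
    (hp : p ∈ polySpace (⊤ : Submodule ℝ ℝ) r) : ∃ q : Polynomial ℝ, p = fun t => q.eval t := by
  obtain ⟨c, -, hc⟩ := hp
  refine ⟨∑ i ∈ Finset.range (r + 1), Polynomial.monomial i (c i), funext fun t => ?_⟩
  simp [hc, Polynomial.eval_finsetSum, mul_comm]

instance finiteDimensional_polySpace (r : ℕ) :
    FiniteDimensional ℝ (polySpace (⊤ : Submodule ℝ ℝ) r) := by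
  have h : polySpace (⊤ : Submodule ℝ ℝ) r ≤
      Submodule.span ℝ (Set.range fun i : Fin (r + 1) => fun t : ℝ => t ^ (i : ℕ)) := by
    rintro p ⟨c, -, hc⟩
    have : p = ∑ i : Fin (r + 1), c i • fun t : ℝ => t ^ (i : ℕ) := by
      funext t
      rw [hc, Finset.sum_range]
      simp [mul_comm]
    rw [this]
    exact Submodule.sum_mem _ fun i _ => Submodule.smul_mem _ _ (Submodule.subset_span ⟨i, rfl⟩)
  have : FiniteDimensional ℝ
      (Submodule.span ℝ (Set.range fun i : Fin (r + 1) => fun t : ℝ => t ^ (i : ℕ))) :=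
    FiniteDimensional.span_of_finite ℝ (Set.finite_range _)
  exact Submodule.finiteDimensional_of_le h

lemma existsUnique_fundamentalSolution {a b lam : ℝ} (hab : a < b) (hlam : 0 < lam) (r : ℕ) :
    ∃! ψ, IsFundamentalSolution a b lam r ψ := by
  set P := polySpace (⊤ : Submodule ℝ ℝ) r with hP
  have hC : ∀ p ∈ P, ContDiff ℝ 1 p := fun p hp => by
    obtain ⟨q, rfl⟩ := exists_polynomial_of_mem hp
    exact q.contDiff_aeval 1
  have hc : ∀ p ∈ P, Continuous p := fun p hp => (hC p hp).continuous
  have hd : ∀ p ∈ P, Differentiable ℝ p := fun p hp => (hC p hp).differentiable (by norm_num)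
  have hdc : ∀ p ∈ P, Continuous (deriv p) := fun p hp => (hC p hp).continuous_deriv le_rfl
  let form (u v : ℝ → ℝ) : ℝ :=
    (∫ s in a..b, deriv u s * v s) + u a * v a + lam * ∫ s in a..b, u s * v s
  have i1 : ∀ u ∈ P, ∀ v ∈ P, IntervalIntegrable (fun s => deriv u s * v s) volume a b :=
    fun u hu v hv => ((hdc u hu).mul (hc v hv)).intervalIntegrable _ _
  have i2 : ∀ u ∈ P, ∀ v ∈ P, IntervalIntegrable (fun s => u s * v s) volume a b :=
    fun u hu v hv => ((hc u hu).mul (hc v hv)).intervalIntegrable _ _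
  let T : P →ₗ[ℝ] Module.Dual ℝ P := LinearMap.mk₂ ℝ (fun u v => form u v)
    (fun u u' v => by
      have e : ∀ s, deriv ((u : ℝ → ℝ) + (u' : ℝ → ℝ)) s = deriv u s + deriv u' s := fun s =>
        deriv_add (hd u u.2 s) (hd u' u'.2 s)
      simp only [form, Submodule.coe_add, e, Pi.add_apply, add_mul]
      rw [intervalIntegral.integral_add (i1 u u.2 v v.2) (i1 u' u'.2 v v.2),
        intervalIntegral.integral_add (i2 u u.2 v v.2) (i2 u' u'.2 v v.2)]
      ring)
    (fun k u v => by
      have e : ∀ s, deriv (k • (u : ℝ → ℝ)) s = k * deriv u s := fun s => by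
        rw [deriv_const_smul _ (hd u u.2 s), smul_eq_mul]
      simp only [form, Submodule.coe_smul, e, Pi.smul_apply, smul_eq_mul, mul_assoc,
        intervalIntegral.integral_const_mul]
      ring)
    (fun u v v' => by
      simp only [form, Submodule.coe_add, Pi.add_apply, mul_add]
      rw [intervalIntegral.integral_add (i1 u u.2 v v.2) (i1 u u.2 v' v'.2),
        intervalIntegral.integral_add (i2 u u.2 v v.2) (i2 u u.2 v' v'.2)]
      ring)
    (fun k u v => by
      simp only [form, Submodule.coe_smul, Pi.smul_apply, smul_eq_mul, mul_left_comm _ k,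
        intervalIntegral.integral_const_mul]
      ring)
  have hT : ∀ u v : P, T u v = form u v := fun u v => rfl
  have hinj : Function.Injective T := by
    rw [injective_iff_map_eq_zero]
    intro u hu
    have h0 : form u u = 0 := by rw [← hT, hu]; rfl
    have hparts : ∫ s in a..b, deriv u s * (u : ℝ → ℝ) s
        = ((u : ℝ → ℝ) b ^ 2 - (u : ℝ → ℝ) a ^ 2) / 2 := by
      rw [intervalIntegral.integral_eq_sub_of_hasDerivAt
        (f := fun s => (u : ℝ → ℝ) s ^ 2 / 2) _ (i1 u u.2 u u.2)]
      · ring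
      · intro s _
        have := ((hd u u.2 s).hasDerivAt.pow 2).div_const 2
        exact this.congr_deriv (by simp; ring)
    have hnn : 0 ≤ ∫ s in a..b, (u : ℝ → ℝ) s * (u : ℝ → ℝ) s :=
      intervalIntegral.integral_nonneg hab.le fun s _ => mul_self_nonneg _
    have hint : ∫ s in a..b, (u : ℝ → ℝ) s * (u : ℝ → ℝ) s = 0 := by
      simp only [form, hparts] at h0
      nlinarith [sq_nonneg ((u : ℝ → ℝ) a), sq_nonneg ((u : ℝ → ℝ) b)]
    have hz : ∀ s ∈ Set.Icc a b, (u : ℝ → ℝ) s = 0 := by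
      intro s hs
      by_contra hne
      have : 0 < ∫ s in a..b, (u : ℝ → ℝ) s * (u : ℝ → ℝ) s :=
        intervalIntegral.integral_pos hab ((hc u u.2).mul (hc u u.2)).continuousOn
          (fun s _ => mul_self_nonneg _) ⟨s, hs, mul_self_pos.2 hne⟩
      exact this.ne' hint
    obtain ⟨q, hq⟩ := exists_polynomial_of_mem u.2
    have hq0 : q = 0 := Polynomial.eq_zero_of_infinite_isRoot q
      ((Set.Icc_infinite hab).mono fun s hs => by
        have := hz s hs
        rw [hq] at this
        exact this)
    apply Subtype.ext
    rw [hq, hq0]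
    funext t
    simp
  have hsurj : Function.Surjective T :=
    (LinearMap.injective_iff_surjective_of_finrank_eq_finrank
      (Subspace.dual_finrank_eq (K := ℝ) (V := P)).symm).1 hinj
  have hiff : ∀ u : P, IsFundamentalSolution a b lam r u ↔
      ∀ v : P, T u v = (v : ℝ → ℝ) a := fun u => by
    have e : ∀ v : ℝ → ℝ,
        ((∫ s in a..b, ⟪ContinuousLinearMap.id ℝ ℝ (deriv u s),
            ContinuousLinearMap.id ℝ ℝ (v s)⟫_ℝ)
          + ⟪ContinuousLinearMap.id ℝ ℝ ((u : ℝ → ℝ) a) - 1, ContinuousLinearMap.id ℝ ℝ (v a)⟫_ℝ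
          + (∫ s in a..b, scalarOp lam ((u : ℝ → ℝ) s) (v s))
          = ∫ s in a..b, ⟪(0 : ℝ → ℝ) s, ContinuousLinearMap.id ℝ ℝ (v s)⟫_ℝ) ↔
        form u v = v a := fun v => by
      have hin : ∀ x y : ℝ, ⟪x, y⟫_ℝ = x * y := fun x y => by simp [mul_comm]
      have hsc : ∀ x y : ℝ, scalarOp lam x y = lam * (x * y) := fun x y => by simp [scalarOp]
      simp only [hin, hsc, ContinuousLinearMap.id_apply, intervalIntegral.integral_const_mul,
        Pi.zero_apply, zero_mul, intervalIntegral.integral_zero, form]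
      constructor <;> intro h <;> linarith
    constructor
    · intro h v
      exact (e v).1 (h.2 v v.2)
    · intro h
      exact ⟨u.2, fun v hv => (e v).2 (h ⟨v, hv⟩)⟩
  let ev : Module.Dual ℝ P := (LinearMap.proj a : (ℝ → ℝ) →ₗ[ℝ] ℝ) ∘ₗ P.subtype
  obtain ⟨u, hu⟩ := hsurj ev
  refine ⟨u, (hiff u).2 fun v => by rw [hu]; rfl, fun w hw => ?_⟩
  have : T ⟨w, hw.1⟩ = T u := by
    ext v
    rw [(hiff ⟨w, hw.1⟩).1 hw v, hu]
    rfl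
  exact congrArg Subtype.val (hinj this)

/-- The dG fundamental solution of degree `r` on `(a, b]` for the rate `lam`. It exists and is unique
for `a < b` and `0 < lam`, see `fundamentalSolution_spec`. -/
def fundamentalSolution (a b lam : ℝ) (r : ℕ) : ℝ → ℝ :=
  Classical.epsilon (IsFundamentalSolution a b lam r)

lemma fundamentalSolution_spec {a b lam : ℝ} (hab : a < b) (hlam : 0 < lam) (r : ℕ) :
    IsFundamentalSolution a b lam r (fundamentalSolution a b lam r) :=
  Classical.epsilon_spec (existsUnique_fundamentalSolution hab hlam r).exists

/-- The pointwise error `e^{-lam (t - a)} - ψ(t)` of the dG fundamental solution. -/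
def fundamentalError (a b lam : ℝ) (r : ℕ) (t : ℝ) : ℝ :=
  Real.exp (-lam * (t - a)) - fundamentalSolution a b lam r t

/-- `Υ(r, ρ) = (3 / (2 (2r + 1) + ρ))^{1/2}`. -/
def upsilon (r : ℕ) (ρ : ℝ) : ℝ :=
  √(3 / (2 * (2 * r + 1) + ρ))

/-- The scalar stability constant
`Υ(r, (b - a) lam) ‖e / e(a)‖_{L^∞(a,b)} + 1`, where `e` is the error of the dG fundamental
solution on `(a, b]`. -/
def scalarConst (a b lam : ℝ) (r : ℕ) : ℝ :=
  upsilon r ((b - a) * lam) *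
    (eLpNorm (fun t => fundamentalError a b lam r t / fundamentalError a b lam r a) ∞
      (volume.restrict (Set.Ioc a b))).toReal + 1

end Scalar

/-- A partition `0 = t_0 < t_1 < ⋯ < t_M = T` of `[0, T]`. The time intervals are indexed by
`i : Fin M`; the one with index `i` is `(t_i, t_{i+1}]`. -/
structure TimePartition (T : ℝ) (M : ℕ) where
  node : Fin (M + 1) → ℝ
  strictMono : StrictMono node
  node_zero : node 0 = 0
  node_last : node (Fin.last M) = T

section Scheme

variable {X H : Type*} [NormedAddCommGroup X] [InnerProductSpace ℝ X]
  [NormedAddCommGroup H] [InnerProductSpace ℝ H] {T : ℝ} {M : ℕ}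

/-- The function on `(0, T]` which on the interval with index `i` is the polynomial `U i`. -/
def TimePartition.glue (τ : TimePartition T M) (U : Fin M → ℝ → X) (t : ℝ) : X :=
  ∑ i : Fin M, (Set.Ioc (τ.node i.castSucc) (τ.node i.succ)).indicator (U i) t

/-- The left limits of the discrete solution at the nodes: the prescribed value `w₀` at `t_0`, and the
value at the right endpoint of the preceding interval at the other nodes. -/
def TimePartition.leftLimit (τ : TimePartition T M) (ι : X →L[ℝ] H) (w₀ : H)
    (U : Fin M → ℝ → X) : Fin (M + 1) → H :=
  Fin.cases w₀ fun i => ι (U i (τ.node i.succ))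

/-- `U` (the family of its polynomial pieces) is the fully discrete dG-in-time / conforming-in-space
solution. `V 0` is the spatial space for the initial value, and `V i.succ` and `r i` are the spatial
space and the polynomial degree on the interval `(t_i, t_{i+1}]`. -/
def IsDGSolution (ι : X →L[ℝ] H) (A : X →L[ℝ] StrongDual ℝ X) (τ : TimePartition T M)
    (V : Fin (M + 1) → Submodule ℝ X) [∀ i, FiniteDimensional ℝ (V i)] (r : Fin M → ℕ)
    (f : ℝ → H) (u₀ : H) (U : Fin M → ℝ → X) : Prop :=
  ∀ i : Fin M, IsDGStep ι A (V i.succ) (r i) (τ.node i.castSucc) (τ.node i.succ)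
    (τ.leftLimit ι (spaceProj ι (V 0) u₀) U i.castSucc) f (U i)

/-- The constant `C` for the time step `(a, b]` with degree `r` and spatial space `V`: the maximum of
the scalar stability constants over the eigenvalues of the discrete operator `A_V : V → V` (with the
value `0` if `V` is the zero space, where there are no eigenvalues). -/
def stepConst (ι : X →L[ℝ] H) (hι : Function.Injective ι) (A : X →L[ℝ] StrongDual ℝ X)
    (V : Submodule ℝ X) [FiniteDimensional ℝ V] (a b : ℝ) (r : ℕ) : ℝ :=
  ⨆ μ : Module.End.Eigenvalues (discreteEnd ι hι A V), scalarConst a b (μ : ℝ) r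

/-- The maximum of the constants of the time steps up to and including the one with index `m`. -/
def gammaConst (ι : X →L[ℝ] H) (hι : Function.Injective ι) (A : X →L[ℝ] StrongDual ℝ X)
    (τ : TimePartition T M) (V : Fin (M + 1) → Submodule ℝ X) [∀ i, FiniteDimensional ℝ (V i)]
    (r : Fin M → ℕ) (m : Fin M) : ℝ :=
  (Finset.Iic m).sup' Finset.nonempty_Iic fun i =>
    stepConst ι hι A (V i.succ) (τ.node i.castSucc) (τ.node i.succ) (r i)

end Scheme

end DGTime

end

/-!
In a basis of `V` which consists of eigenvectors of the discrete operator and is orthonormal in `H`, a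
dG step decouples into scalar dG steps for `u' + lam u = g` (`IsEigenbasis.isDGStep_iff`), and the
coefficients are put together again with Bessel's inequality. So everything rests on two scalar
estimates on a step `[a, b]` of length `k`, with all constants independent of `lam > 0`.

The central object is the Radau polynomial `Θ` of degree `r + 1` with `Θ(a) = 1`, for which `-Θ'`
represents the evaluation at `a` on polynomials of degree at most `r`. With it the scheme has the strong
form `u' + lam u = F + (u(a) - w) Θ'`, where `F` is the `L²`-projection of `g`. Moreover `Θ` is a
hypergeometric polynomial, so each of its derivatives solves a second order differential equation; Sonin's argument
(`abs_radauPoly_le`) shows that each derivative has its largest modulus at `a`, and the signs there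
alternate.

* For `g = 0`, `w = 1` the strong form is solved explicitly: `ψ` is a positive multiple of
  `∑_{j ≥ 1} (-lam)^(-j) Θ^(j)`. By the above all terms have their largest modulus at `a` and are
  nonnegative there, whence `|ψ| ≤ ψ(a) ≤ 1` (`abs_fundPoly_le`). Moreover the normalized error `e / e(a)` solves
  `y' + lam y = Θ'`, `y(a) = 1`, which gives `|e / e(a)| ≤ 2` (`abs_errorRatio_le`) and the bounds of
  the constants.
* For `w = 0`, the solution is `z = z(a) e / e(a) + y` with `y' + lam y = F`, `y(a) = 0`, hence
  `|y| ≤ √k ‖F‖ ≤ √k ‖g‖`. Testing the scheme with the Legendre polynomial of degree `r` and with `z`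
  itself gives `(2 r + 1 + k lam) z(a)² ≤ k ‖g‖²` (`IsScalarStep.eval_left_sq_le`). Together these are
  `IsScalarStep.abs_eval_le`.

The estimates of the steps are summed with the Cauchy-Schwarz inequality (`norm_isDGSolution_le`).
Existence and uniqueness also follow from the scalar estimates, step by step.
-/

noncomputable section

namespace DGTime

open Polynomial

/-! ### Radau polynomials on the unit interval -/

/-- The coefficients of the hypergeometric polynomial `₂F₁(-n, n; 1; s)`. -/
def radauCoeff (n : ℕ) : ℕ → ℝ
  | 0 => 1
  | j + 1 => -((n : ℝ) ^ 2 - (j : ℝ) ^ 2) / ((j : ℝ) + 1) ^ 2 * radauCoeff n j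

/-- The Radau polynomial `θ_n(s) = ₂F₁(-n, n; 1; s)` of degree `n` on `[0, 1]`. In terms of the
Legendre polynomials on `[0, 1]` it is `(-1)^(n-1) (L_{n-1} - L_n) / 2` for `n ≥ 1`. -/
def radauPoly (n : ℕ) : ℝ[X] :=
  ∑ j ∈ Finset.range (n + 1), monomial j (radauCoeff n j)

lemma radauCoeff_eq_zero {n j : ℕ} (h : n < j) : radauCoeff n j = 0 := by
  induction j with
  | zero => omega
  | succ j ih =>
    rcases Nat.lt_succ_iff_lt_or_eq.1 h with h | rfl
    · simp [radauCoeff, ih h]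
    · simp [radauCoeff]

lemma coeff_radauPoly (n j : ℕ) : (radauPoly n).coeff j = radauCoeff n j := by
  simp only [radauPoly, finsetSum_coeff, coeff_monomial, Finset.sum_ite_eq', Finset.mem_range]
  split_ifs with h
  · rfl
  · exact (radauCoeff_eq_zero (by omega)).symm

lemma natDegree_radauPoly_le (n : ℕ) : (radauPoly n).natDegree ≤ n :=
  natDegree_le_iff_coeff_eq_zero.2 fun j hj => by
    rw [coeff_radauPoly, radauCoeff_eq_zero hj]

lemma radauPoly_eval_zero (n : ℕ) : (radauPoly n).eval 0 = 1 := by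
  rw [← coeff_zero_eq_eval_zero, coeff_radauPoly]
  rfl

lemma radauPoly_ode_zero (n : ℕ) :
    X * (1 - X) * derivative (derivative (radauPoly n)) + (1 - X) * derivative (radauPoly n)
      + C ((n : ℝ) ^ 2) * radauPoly n = 0 := by
  have e : X * (1 - X) * derivative (derivative (radauPoly n)) + (1 - X) * derivative (radauPoly n)
      + C ((n : ℝ) ^ 2) * radauPoly n =
      X * derivative (derivative (radauPoly n)) - X * (X * derivative (derivative (radauPoly n)))
        + derivative (radauPoly n) - X * derivative (radauPoly n)
        + C ((n : ℝ) ^ 2) * radauPoly n := by ring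
  rw [e]
  ext j
  have h : radauCoeff n (j + 1) * ((j : ℝ) + 1) ^ 2 =
      -((n : ℝ) ^ 2 - (j : ℝ) ^ 2) * radauCoeff n j := by
    have : ((j : ℝ) + 1) ≠ 0 := by positivity
    rw [radauCoeff]; field_simp
  clear e
  generalize (n : ℝ) ^ 2 = N at h ⊢
  rcases j with _ | _ | j
  · simp [coeff_derivative, coeff_radauPoly] at h ⊢
    linarith
  · simp [coeff_derivative, coeff_radauPoly] at h ⊢
    linarith
  · simp [coeff_derivative, coeff_radauPoly] at h ⊢
    linarith

/-- The hypergeometric differential equation of the derivatives of the Radau polynomial. -/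
lemma radauPoly_ode (n j : ℕ) :
    X * (1 - X) * derivative^[j + 2] (radauPoly n)
      + (C (1 + (j : ℝ)) - C (2 * (j : ℝ) + 1) * X) * derivative^[j + 1] (radauPoly n)
      + C ((n : ℝ) ^ 2 - (j : ℝ) ^ 2) * derivative^[j] (radauPoly n) = 0 := by
  induction j with
  | zero =>
    have := radauPoly_ode_zero n
    simpa using this
  | succ j ih =>
    have h := congrArg derivative ih
    simp only [derivative_add, derivative_mul, derivative_sub, derivative_X, derivative_C,
      derivative_one, derivative_zero, ← Function.iterate_succ_apply' derivative] at h
    rw [← h]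
    simp only [C_add, C_sub, C_mul, C_pow, Nat.cast_add, Nat.cast_one, map_one, map_ofNat]
    ring

lemma radauPoly_ode_eval (n j : ℕ) (s : ℝ) :
    s * (1 - s) * (derivative^[j + 2] (radauPoly n)).eval s
      + (1 + (j : ℝ) - (2 * (j : ℝ) + 1) * s) * (derivative^[j + 1] (radauPoly n)).eval s
      + ((n : ℝ) ^ 2 - (j : ℝ) ^ 2) * (derivative^[j] (radauPoly n)).eval s = 0 := by
  have := congrArg (eval s) (radauPoly_ode n j)
  simpa only [eval_add, eval_mul, eval_sub, eval_X, eval_C, eval_one, eval_zero] using this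

lemma iterate_derivative_radauPoly_eq_zero {n j : ℕ} (h : n < j) :
    derivative^[j] (radauPoly n) = 0 :=
  iterate_derivative_eq_zero ((natDegree_radauPoly_le n).trans_lt h)

/-- The derivatives of the Radau polynomial at `0` alternate in sign. -/
lemma radauPoly_sign (n j : ℕ) : 0 ≤ (-1) ^ j * (derivative^[j] (radauPoly n)).eval 0 := by
  induction j with
  | zero => simp [radauPoly_eval_zero]
  | succ j ih =>
    rcases lt_or_ge n j with h | h
    · simp [iterate_derivative_radauPoly_eq_zero (h.trans (Nat.lt_succ_self j))]
    · have e := radauPoly_ode_eval n j 0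
      have hN : 0 ≤ (n : ℝ) ^ 2 - (j : ℝ) ^ 2 := by
        have : (j : ℝ) ≤ n := by exact_mod_cast h
        nlinarith [(Nat.cast_nonneg j : (0 : ℝ) ≤ j)]
      have hj : (0 : ℝ) < 1 + j := by positivity
      refine nonneg_of_mul_nonneg_right (b := _) (a := 1 + (j : ℝ)) ?_ hj
      have : (1 + (j : ℝ)) * ((-1) ^ (j + 1) * (derivative^[j + 1] (radauPoly n)).eval 0) =
          ((n : ℝ) ^ 2 - (j : ℝ) ^ 2) * ((-1) ^ j * (derivative^[j] (radauPoly n)).eval 0) := by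
        rw [pow_succ]
        linear_combination (-(-1) ^ j) * e
      rw [this]
      exact mul_nonneg hN ih

lemma abs_radauPoly_zero (n j : ℕ) : |(derivative^[j] (radauPoly n)).eval 0| =
    (-1) ^ j * (derivative^[j] (radauPoly n)).eval 0 := by
  rw [← abs_of_nonneg (radauPoly_sign n j), abs_mul, abs_pow, abs_neg, abs_one, one_pow, one_mul]

/-- The differential equation at `s = 0` and at `s = 1` relates consecutive derivatives there, and the
`n`-th derivative is constant. Descending from it compares the two endpoints for every derivative. -/
lemma radauPoly_endpoints {n j : ℕ} (h : j ≤ n) :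
    n * |(derivative^[j] (radauPoly n)).eval 1| = j * |(derivative^[j] (radauPoly n)).eval 0| := by
  induction h using Nat.decreasingInduction with
  | self =>
    -- The `n`-th derivative is constant.
    have : (derivative^[n] (radauPoly n)).natDegree = 0 := by
      have := natDegree_iterate_derivative (radauPoly n) n
      have := natDegree_radauPoly_le n
      omega
    obtain ⟨c, hc⟩ := natDegree_eq_zero.1 this
    rw [← hc]; simp
  | of_succ j hj ih =>
    have e0 := radauPoly_ode_eval n j 0
    have e1 := radauPoly_ode_eval n j 1
    have hN : 0 < (n : ℝ) ^ 2 - (j : ℝ) ^ 2 := by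
      have : (j : ℝ) < n := by exact_mod_cast hj
      nlinarith [(Nat.cast_nonneg j : (0 : ℝ) ≤ j)]
    have key : ∀ {p q u v : ℝ}, 0 ≤ p → 0 ≤ q → |p * u| = |q * v| → p * |u| = q * |v| :=
      fun hp hq h => by rwa [abs_mul, abs_mul, abs_of_nonneg hp, abs_of_nonneg hq] at h
    have a0 : ((n : ℝ) ^ 2 - (j : ℝ) ^ 2) * |(derivative^[j] (radauPoly n)).eval 0| =
        (j + 1) * |(derivative^[j + 1] (radauPoly n)).eval 0| := by
      refine key hN.le (by positivity) ?_
      rw [← abs_neg]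
      congr 1
      linarith
    have a1 : ((n : ℝ) ^ 2 - (j : ℝ) ^ 2) * |(derivative^[j] (radauPoly n)).eval 1| =
        j * |(derivative^[j + 1] (radauPoly n)).eval 1| := by
      refine key hN.le (by positivity) ?_
      congr 1
      linarith
    apply mul_left_cancel₀ hN.ne'
    push_cast at ih
    linear_combination (n : ℝ) * a1 - (j : ℝ) * a0 + (j : ℝ) * ih

lemma abs_radauPoly_one_le {n : ℕ} (hn : 0 < n) (j : ℕ) :
    |(derivative^[j] (radauPoly n)).eval 1| ≤ |(derivative^[j] (radauPoly n)).eval 0| := by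
  rcases lt_or_ge n j with h | h
  · simp [iterate_derivative_radauPoly_eq_zero h]
  · have e := radauPoly_endpoints h
    have hn' : (0 : ℝ) < n := by exact_mod_cast hn
    refine le_of_mul_le_mul_left ?_ hn'
    rw [e]
    gcongr

lemma radauPoly_eval_one {n : ℕ} (hn : 0 < n) : (radauPoly n).eval 1 = 0 := by
  have e := radauPoly_endpoints hn.le
  simpa [hn.ne'] using e

/-- Every derivative of the Radau polynomial attains its maximal modulus on `[0, 1]` at `0`. This is
Sonin's argument: for `y` the `j`-th derivative, `(n² - j²) y² + s (1 - s) y'²` has the derivative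
`(4 j s - 1 - 2 j) y'²`, hence first decreases and then increases, and is largest at an endpoint. -/
lemma abs_radauPoly_le {n : ℕ} (hn : 0 < n) (j : ℕ) {s : ℝ} (hs : s ∈ Set.Icc (0 : ℝ) 1) :
    |(derivative^[j] (radauPoly n)).eval s| ≤ |(derivative^[j] (radauPoly n)).eval 0| := by
  rcases lt_trichotomy n j with h | rfl | h
  · simp [iterate_derivative_radauPoly_eq_zero h]
  · have : (derivative^[n] (radauPoly n)).natDegree = 0 := by
      have := natDegree_iterate_derivative (radauPoly n) n
      have := natDegree_radauPoly_le n
      omega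
    obtain ⟨c, hc⟩ := natDegree_eq_zero.1 this
    rw [← hc]; simp
  have hN : 0 < (n : ℝ) ^ 2 - (j : ℝ) ^ 2 := by
    have : (j : ℝ) < n := by exact_mod_cast h
    nlinarith [(Nat.cast_nonneg j : (0 : ℝ) ≤ j)]
  have hj0 : (0 : ℝ) ≤ j := Nat.cast_nonneg j
  set N := (n : ℝ) ^ 2 - (j : ℝ) ^ 2 with hNdef
  set y := derivative^[j] (radauPoly n) with hy
  set F : ℝ[X] := C N * y ^ 2 + X * (1 - X) * derivative y ^ 2 with hF
  have hF' : ∀ x, deriv (fun x => F.eval x) x =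
      (4 * j * x - 1 - 2 * j) * (derivative y).eval x ^ 2 := by
    intro x
    have e := radauPoly_ode_eval n j x
    rw [Function.iterate_succ_apply', Function.iterate_succ_apply', ← hy, ← hNdef] at e
    rw [Polynomial.deriv, hF]
    simp only [derivative_add, derivative_mul, derivative_sub, derivative_X, derivative_C,
      derivative_one, derivative_pow, eval_add, eval_mul, eval_sub, eval_X, eval_C, eval_one,
      eval_zero, eval_pow, Nat.cast_ofNat]
    linear_combination (2 * (derivative y).eval x) * e
  have hFN : ∀ x ∈ Set.Icc (0 : ℝ) 1, N * y.eval x ^ 2 ≤ F.eval x := fun x hx => by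
    have : 0 ≤ x * (1 - x) * (derivative y).eval x ^ 2 :=
      mul_nonneg (mul_nonneg hx.1 (by linarith [hx.2])) (sq_nonneg _)
    simp only [hF, eval_add, eval_mul, eval_sub, eval_X, eval_C, eval_one, eval_pow]
    linarith
  have hF0 : F.eval 0 = N * y.eval 0 ^ 2 := by simp [hF]
  have hF1 : F.eval 1 ≤ N * y.eval 0 ^ 2 := by
    have := sq_le_sq.2 (abs_radauPoly_one_le hn j)
    simp only [hF, eval_add, eval_mul, eval_sub, eval_X, eval_C, eval_one, eval_pow]
    rw [← hy] at this
    nlinarith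
  have key : F.eval s ≤ N * y.eval 0 ^ 2 := by
    rcases le_total (4 * j * s) (1 + 2 * j) with hc | hc
    · rw [← hF0]
      refine antitoneOn_of_deriv_nonpos (convex_Icc 0 s) F.continuous.continuousOn
        F.differentiable.differentiableOn (fun x hx => ?_) (Set.left_mem_Icc.2 hs.1)
        (Set.right_mem_Icc.2 hs.1) hs.1
      rw [interior_Icc] at hx
      rw [hF']
      refine mul_nonpos_of_nonpos_of_nonneg ?_ (sq_nonneg _)
      nlinarith [mul_le_mul_of_nonneg_left hx.2.le hj0]
    · refine le_trans ?_ hF1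
      refine monotoneOn_of_deriv_nonneg (convex_Icc s 1) F.continuous.continuousOn
        F.differentiable.differentiableOn (fun x hx => ?_) (Set.left_mem_Icc.2 hs.2)
        (Set.right_mem_Icc.2 hs.2) hs.2
      rw [interior_Icc] at hx
      rw [hF']
      refine mul_nonneg ?_ (sq_nonneg _)
      nlinarith [mul_le_mul_of_nonneg_left hx.1.le hj0]
  exact sq_le_sq.1 (le_of_mul_le_mul_left ((hFN s hs).trans key) hN)

lemma integral_derivative_eval (p : ℝ[X]) (a b : ℝ) :
    ∫ s in a..b, (derivative p).eval s = p.eval b - p.eval a :=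
  intervalIntegral.integral_eq_sub_of_hasDerivAt (fun s _ => p.hasDerivAt s)
    ((derivative p).continuous.intervalIntegrable _ _)

/-- The differential equation of `y = θ_n'`, tested with `s ^ (m + 1)` and integrated by parts, gives
`m (m + 1) ∫ s ^ m y + (n² - (m + 1)²) ∫ s ^ (m + 1) y = 0`, which starts at `m = 0`. -/
lemma integral_radau_moment {n m : ℕ} (hm : 0 < m) (hmn : m < n) :
    ∫ s in (0 : ℝ)..1, s ^ m * (derivative (radauPoly n)).eval s = 0 := by
  have hrec : ∀ m : ℕ, m * (m + 1) * (∫ s in (0 : ℝ)..1, s ^ m * (derivative (radauPoly n)).eval s)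
      + ((n : ℝ) ^ 2 - (m + 1) ^ 2)
        * (∫ s in (0 : ℝ)..1, s ^ (m + 1) * (derivative (radauPoly n)).eval s) = 0 := by
    intro m
    set y := derivative (radauPoly n) with hy
    set G : ℝ[X] := C (m : ℝ) * X ^ (m + 1) * (1 - X) * y - X ^ (m + 2) * (1 - X) * derivative y
      with hG
    have hG' : ∀ s, (derivative G).eval s = m * (m + 1) * (s ^ m * y.eval s)
        + ((n : ℝ) ^ 2 - (m + 1) ^ 2) * (s ^ (m + 1) * y.eval s) := by
      intro s
      have e := radauPoly_ode_eval n 1 s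
      rw [show (1 + 2) = 2 + 1 from rfl, Function.iterate_succ_apply, Function.iterate_succ_apply,
        Function.iterate_succ_apply, Function.iterate_succ_apply, Function.iterate_succ_apply,
        Function.iterate_succ_apply, Function.iterate_zero_apply, ← hy] at e
      simp only [Function.iterate_zero_apply, Nat.cast_one] at e
      simp only [hG, derivative_mul, derivative_sub, derivative_X,
        derivative_one, derivative_X_pow, eval_add, eval_mul, eval_sub, eval_X, eval_one,
        eval_zero, eval_pow, Nat.cast_add, Nat.cast_ofNat, Nat.cast_one, Nat.add_sub_cancel,
        show m + 2 - 1 = m + 1 by omega, map_add, map_natCast, eval_natCast, map_one, map_ofNat,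
        eval_ofNat, derivative_natCast]
      linear_combination (-s ^ (m + 1)) * e
    have hI := integral_derivative_eval G 0 1
    simp only [hG'] at hI
    rw [intervalIntegral.integral_add, intervalIntegral.integral_const_mul,
      intervalIntegral.integral_const_mul] at hI
    · rw [hI]; simp [hG]
    · exact Continuous.intervalIntegrable (by fun_prop) _ _
    · exact Continuous.intervalIntegrable (by fun_prop) _ _
  induction m with
  | zero => omega
  | succ m ih =>
    have h := hrec m
    have hN : (n : ℝ) ^ 2 - (m + 1) ^ 2 ≠ 0 := by
      have : (m : ℝ) + 1 < n := by exact_mod_cast hmn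
      have : (0 : ℝ) ≤ m := Nat.cast_nonneg m
      nlinarith
    have h0 : (m : ℝ) * (m + 1)
        * (∫ s in (0 : ℝ)..1, s ^ m * (derivative (radauPoly n)).eval s) = 0 := by
      rcases Nat.eq_zero_or_pos m with rfl | hm'
      · simp
      · rw [ih hm' (by omega), mul_zero]
    rw [h0, zero_add] at h
    exact (mul_eq_zero.1 h).resolve_left hN

/-- The polynomial `-θ_n'` represents the evaluation at `0` on polynomials of degree less than `n`. -/
lemma integral_radau_mul {n : ℕ} {v : ℝ[X]} (hv : v.natDegree < n) :
    ∫ s in (0 : ℝ)..1, (derivative (radauPoly n)).eval s * v.eval s = -v.eval 0 := by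
  have e : ∀ s : ℝ, (derivative (radauPoly n)).eval s * v.eval s =
      ∑ m ∈ Finset.range n, v.coeff m * (s ^ m * (derivative (radauPoly n)).eval s) := fun s => by
    rw [eval_eq_sum_range' hv, Finset.mul_sum]
    exact Finset.sum_congr rfl fun _ _ => by ring
  simp only [e]
  rw [intervalIntegral.integral_finsetSum fun m _ =>
    Continuous.intervalIntegrable (by fun_prop) _ _]
  simp only [intervalIntegral.integral_const_mul]
  rw [Finset.sum_eq_single 0]
  · have h := integral_derivative_eval (radauPoly n) 0 1
    rw [radauPoly_eval_zero, radauPoly_eval_one (by omega)] at h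
    simp [h, coeff_zero_eq_eval_zero]
  · intro m hm hm0
    rw [integral_radau_moment (Nat.pos_of_ne_zero hm0) (Finset.mem_range.1 hm), mul_zero]
  · intro h
    simp only [Finset.mem_range] at h
    omega

lemma derivative_radauPoly_eval_zero (n : ℕ) : (derivative (radauPoly n)).eval 0 = -(n : ℝ) ^ 2 := by
  have := radauPoly_ode_eval n 0 0
  simp [radauPoly_eval_zero] at this
  linarith

/-! ### Radau and Legendre polynomials on a time step -/

/-- The Radau polynomial of degree `n`, transported from `[0, 1]` to `[a, b]`. -/
def radauOn (a b : ℝ) (n : ℕ) : ℝ[X] :=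
  (radauPoly n).comp (C (b - a)⁻¹ * (X - C a))

lemma iterate_derivative_radauOn (a b : ℝ) (n j : ℕ) : derivative^[j] (radauOn a b n) =
    C ((b - a)⁻¹ ^ j) * (derivative^[j] (radauPoly n)).comp (C (b - a)⁻¹ * (X - C a)) := by
  induction j with
  | zero => simp [radauOn]
  | succ j ih =>
    rw [Function.iterate_succ_apply', ih, derivative_C_mul, derivative_comp, derivative_C_mul,
      derivative_sub, derivative_X, derivative_C, Function.iterate_succ_apply', pow_succ, C_mul]
    ring

lemma eval_iterate_derivative_radauOn (a b : ℝ) (n j : ℕ) (t : ℝ) :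
    (derivative^[j] (radauOn a b n)).eval t =
      (b - a)⁻¹ ^ j * (derivative^[j] (radauPoly n)).eval ((b - a)⁻¹ * (t - a)) := by
  simp [iterate_derivative_radauOn, eval_comp]

lemma eval_derivative_radauOn (a b : ℝ) (n : ℕ) (t : ℝ) :
    (derivative (radauOn a b n)).eval t =
      (b - a)⁻¹ * (derivative (radauPoly n)).eval ((b - a)⁻¹ * (t - a)) := by
  simpa using eval_iterate_derivative_radauOn a b n 1 t

lemma radauOn_eval_left (a b : ℝ) (n : ℕ) : (radauOn a b n).eval a = 1 := by
  simp [radauOn, eval_comp, radauPoly_eval_zero]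

lemma natDegree_radauOn_le (a b : ℝ) (n : ℕ) : (radauOn a b n).natDegree ≤ n := by
  refine natDegree_comp_le.trans ?_
  have h : (C (b - a)⁻¹ * (X - C a)).natDegree ≤ 1 :=
    (natDegree_C_mul_le _ _).trans (natDegree_X_sub_C a).le
  calc _ ≤ n * 1 := Nat.mul_le_mul (natDegree_radauPoly_le n) h
    _ = n := mul_one n

lemma natDegree_iterate_derivative_radauOn_le (a b : ℝ) (n j : ℕ) :
    (derivative^[j] (radauOn a b n)).natDegree ≤ n - j :=
  (natDegree_iterate_derivative _ _).trans (Nat.sub_le_sub_right (natDegree_radauOn_le a b n) j)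

lemma abs_radauOn_left {a b : ℝ} (hab : a < b) (n j : ℕ) :
    |(derivative^[j] (radauOn a b n)).eval a| =
      (-1) ^ j * (derivative^[j] (radauOn a b n)).eval a := by
  have hk : 0 < (b - a)⁻¹ := inv_pos.2 (sub_pos.2 hab)
  rw [eval_iterate_derivative_radauOn, sub_self, mul_zero, abs_mul, abs_radauPoly_zero,
    abs_of_pos (pow_pos hk j)]
  ring

lemma abs_radauOn_le {a b : ℝ} (hab : a < b) {n : ℕ} (hn : 0 < n) (j : ℕ) {t : ℝ}
    (ht : t ∈ Set.Icc a b) :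
    |(derivative^[j] (radauOn a b n)).eval t| ≤ |(derivative^[j] (radauOn a b n)).eval a| := by
  have hk : 0 < b - a := sub_pos.2 hab
  rw [eval_iterate_derivative_radauOn, eval_iterate_derivative_radauOn, sub_self, mul_zero, abs_mul,
    abs_mul]
  refine mul_le_mul_of_nonneg_left ?_ (abs_nonneg _)
  refine abs_radauPoly_le hn j ⟨mul_nonneg (inv_nonneg.2 hk.le) (sub_nonneg.2 ht.1), ?_⟩
  rw [inv_mul_le_one₀ hk]
  linarith [ht.2]

/-- The derivative of the Radau polynomial represents minus the evaluation at the left endpoint. -/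
lemma integral_derivative_radauOn_mul {a b : ℝ} (hab : a < b) {n : ℕ} {v : ℝ[X]}
    (hv : v.natDegree < n) :
    ∫ s in a..b, (derivative (radauOn a b n)).eval s * v.eval s = -v.eval a := by
  have hk : b - a ≠ 0 := (sub_pos.2 hab).ne'
  set q : ℝ[X] := v.comp (C (b - a) * X + C a) with hq
  have hqd : q.natDegree < n := by
    refine lt_of_le_of_lt natDegree_comp_le ?_
    have h : (C (b - a) * X + C a).natDegree ≤ 1 := natDegree_linear_le
    calc _ ≤ v.natDegree * 1 := Nat.mul_le_mul le_rfl h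
      _ < n := by rwa [mul_one]
  have h := integral_radau_mul hqd
  have e : ∀ s, (derivative (radauOn a b n)).eval s * v.eval s =
      (b - a)⁻¹ * (fun x => (derivative (radauPoly n)).eval x * q.eval x)
        ((b - a)⁻¹ * s - (b - a)⁻¹ * a) := by
    intro s
    have : (b - a) * ((b - a)⁻¹ * s - (b - a)⁻¹ * a) + a = s := by field_simp; ring
    simp only [eval_derivative_radauOn, hq, eval_comp, eval_add, eval_mul, eval_C, eval_X, this]
    rw [mul_sub]; ring
  simp only [e]
  rw [intervalIntegral.integral_const_mul, intervalIntegral.integral_comp_mul_sub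
    (fun x => (derivative (radauPoly n)).eval x * q.eval x) (inv_ne_zero hk)]
  have h1 : (b - a)⁻¹ * b - (b - a)⁻¹ * a = 1 := by field_simp
  rw [sub_self, h1, h]
  simp [hq, eval_comp, hk]

/-- The Legendre polynomial of degree `r` on `[a, b]`, with the value `1` at `a`. -/
def legendreOn (a b : ℝ) (r : ℕ) : ℝ[X] :=
  C ((b - a) / (2 * r + 1)) * (derivative (radauOn a b r) - derivative (radauOn a b (r + 1)))

lemma legendreOn_eval_left {a b : ℝ} (hab : a < b) (r : ℕ) : (legendreOn a b r).eval a = 1 := by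
  have hk : b - a ≠ 0 := (sub_pos.2 hab).ne'
  have hr : (2 * (r : ℝ) + 1) ≠ 0 := by positivity
  simp only [legendreOn, eval_mul, eval_C, eval_sub, eval_derivative_radauOn, sub_self, mul_zero,
    derivative_radauPoly_eval_zero]
  push_cast
  field_simp
  ring

lemma natDegree_legendreOn_le (a b : ℝ) (r : ℕ) : (legendreOn a b r).natDegree ≤ r := by
  refine (natDegree_C_mul_le _ _).trans ((natDegree_sub_le _ _).trans (max_le ?_ ?_))
  · have := natDegree_iterate_derivative_radauOn_le a b r 1
    rw [Function.iterate_one] at this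
    omega
  · have := natDegree_iterate_derivative_radauOn_le a b (r + 1) 1
    rw [Function.iterate_one] at this
    omega

lemma integral_legendreOn_mul {a b : ℝ} (hab : a < b) {r : ℕ} {v : ℝ[X]} (hv : v.natDegree < r) :
    ∫ s in a..b, (legendreOn a b r).eval s * v.eval s = 0 := by
  simp only [legendreOn, eval_mul, eval_C, eval_sub, mul_assoc, sub_mul,
    intervalIntegral.integral_const_mul]
  rw [intervalIntegral.integral_sub (Continuous.intervalIntegrable (by fun_prop) _ _)
    (Continuous.intervalIntegrable (by fun_prop) _ _), integral_derivative_radauOn_mul hab hv,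
    integral_derivative_radauOn_mul hab (hv.trans (Nat.lt_succ_self r)), sub_self, mul_zero]

lemma integral_legendreOn_mul_derivative {a b : ℝ} (hab : a < b) {r : ℕ} {v : ℝ[X]}
    (hv : v.natDegree ≤ r) :
    ∫ s in a..b, (derivative v).eval s * (legendreOn a b r).eval s = 0 := by
  rcases Nat.eq_zero_or_pos v.natDegree with h | h
  · rw [derivative_of_natDegree_zero h]
    simp
  · simp_rw [mul_comm (eval _ (derivative v))]
    exact integral_legendreOn_mul hab ((natDegree_derivative_lt h.ne').trans_le hv)

lemma integral_legendreOn_sq {a b : ℝ} (hab : a < b) (r : ℕ) :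
    ∫ s in a..b, (legendreOn a b r).eval s ^ 2 = (b - a) / (2 * r + 1) := by
  have e : ∀ s, (legendreOn a b r).eval s ^ 2 = (b - a) / (2 * r + 1) *
      ((derivative (radauOn a b r)).eval s * (legendreOn a b r).eval s
        - (derivative (radauOn a b (r + 1))).eval s * (legendreOn a b r).eval s) := fun s => by
    rw [sq]
    nth_rewrite 1 [legendreOn]
    simp only [eval_mul, eval_C, eval_sub]
    ring
  simp only [e]
  rw [intervalIntegral.integral_const_mul,
    intervalIntegral.integral_sub (Continuous.intervalIntegrable (by fun_prop) _ _)
    (Continuous.intervalIntegrable (by fun_prop) _ _),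
    integral_legendreOn_mul_derivative hab (natDegree_radauOn_le a b r),
    integral_derivative_radauOn_mul hab (Nat.lt_succ_of_le (natDegree_legendreOn_le a b r)),
    legendreOn_eval_left hab]
  ring

/-! ### Integral inequalities -/

lemma sq_integral_mul_le {α : Type*} [MeasurableSpace α] {μ : Measure α} {f g : α → ℝ}
    (hf : MemLp f 2 μ) (hg : MemLp g 2 μ) :
    (∫ x, f x * g x ∂μ) ^ 2 ≤ (∫ x, f x ^ 2 ∂μ) * ∫ x, g x ^ 2 ∂μ := by
  have hfg : Integrable (fun x => f x * g x) μ := hf.integrable_mul hg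
  have h : ∀ c : ℝ, 0 ≤ (∫ x, g x ^ 2 ∂μ) * (c * c) + 2 * (∫ x, f x * g x ∂μ) * c
      + ∫ x, f x ^ 2 ∂μ := fun c => by
    have : 0 ≤ ∫ x, (f x + c * g x) ^ 2 ∂μ := integral_nonneg fun _ => sq_nonneg _
    have e : ∀ x, (f x + c * g x) ^ 2 = f x ^ 2 + (2 * c) * (f x * g x) + c ^ 2 * g x ^ 2 :=
      fun x => by ring
    simp only [e] at this
    have hadd : Integrable (fun x => f x ^ 2 + (2 * c) * (f x * g x)) μ :=
      hf.integrable_sq.add (hfg.const_mul _)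
    rw [integral_add hadd (hg.integrable_sq.const_mul _),
      integral_add hf.integrable_sq (hfg.const_mul _), integral_const_mul, integral_const_mul]
      at this
    linarith
  have := discrim_le_zero h
  rw [discrim] at this
  linarith

lemma memLp_Ioc_of_continuous {h : ℝ → ℝ} (hh : Continuous h) (a b : ℝ) :
    MemLp h 2 (volume.restrict (Set.Ioc a b)) :=
  (memLp_two_iff_integrable_sq hh.aestronglyMeasurable).2
    (((hh.pow 2).integrableOn_Icc).mono_set Set.Ioc_subset_Icc_self)

/-- An essential bound of a continuous function on an interval holds at every point of its closure. -/
lemma abs_le_of_ae_restrict_Ioc {h : ℝ → ℝ} (hh : Continuous h) {a b c : ℝ} (hab : a < b)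
    (hc : ∀ᵐ t ∂volume.restrict (Set.Ioc a b), |h t| ≤ c) {t : ℝ} (ht : t ∈ Set.Icc a b) :
    |h t| ≤ c := by
  by_contra hlt
  rw [not_le] at hlt
  have hopen : IsOpen {x | c < |h x|} := isOpen_lt continuous_const hh.abs
  rw [← closure_Ioo hab.ne] at ht
  have hne := mem_closure_iff.1 ht _ hopen hlt
  have hpos := (hopen.inter isOpen_Ioo).measure_pos volume hne
  rw [ae_restrict_iff' measurableSet_Ioc] at hc
  refine hpos.ne' (measure_mono_null (fun x hx => ?_) (ae_iff.1 hc))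
  simp only [Set.mem_ofPred_eq, Classical.not_imp, not_le]
  exact ⟨Set.Ioo_subset_Ioc_self hx.2, hx.1⟩

/-- A solution of `y' + lam y = F` with zero initial value is bounded by `∫ |F|`, since
`(e^{lam (s - a)} y)' = e^{lam (s - a)} F`. -/
lemma abs_le_integral_of_ode {a t lam : ℝ} (hlam : 0 ≤ lam) (hat : a ≤ t) {y F : ℝ → ℝ}
    (hF : Continuous F) (hy : ∀ s, HasDerivAt y (F s - lam * y s) s) (ha : y a = 0) :
    |y t| ≤ ∫ s in a..t, |F s| := by
  have hd : ∀ s, HasDerivAt (fun s => Real.exp (lam * (s - a)) * y s)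
      (Real.exp (lam * (s - a)) * F s) s := fun s => by
    have h1 : HasDerivAt (fun s => Real.exp (lam * (s - a))) (Real.exp (lam * (s - a)) * lam) s := by
      have := (((hasDerivAt_id s).sub_const a).const_mul lam).exp
      simpa using this
    exact (h1.mul (hy s)).congr_deriv (by ring)
  have hI := intervalIntegral.integral_eq_sub_of_hasDerivAt (a := a) (b := t) (fun s _ => hd s)
    (Continuous.intervalIntegrable (by fun_prop) _ _)
  rw [ha, mul_zero, sub_zero] at hI
  have hpos := Real.exp_pos (lam * (t - a))
  refine le_of_mul_le_mul_left ?_ hpos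
  calc Real.exp (lam * (t - a)) * |y t| = |∫ s in a..t, Real.exp (lam * (s - a)) * F s| := by
        rw [hI, abs_mul, abs_of_pos hpos]
    _ ≤ ∫ s in a..t, |Real.exp (lam * (s - a)) * F s| :=
        intervalIntegral.abs_integral_le_integral_abs hat
    _ ≤ ∫ s in a..t, Real.exp (lam * (t - a)) * |F s| := by
        refine intervalIntegral.integral_mono_on hat
          (Continuous.intervalIntegrable (by fun_prop) _ _)
          (Continuous.intervalIntegrable (by fun_prop) _ _) fun s hs => ?_
        rw [abs_mul, Real.abs_exp]
        gcongr
        exact hs.2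
    _ = _ := intervalIntegral.integral_const_mul _ _

/-! ### The scalar dG step -/

/-- The scalar dG step for `u' + lam u = g`, with the solution and the test functions given as
elements of `ℝ[X]`. -/
structure IsScalarStep (a b lam : ℝ) (r : ℕ) (w : ℝ) (g : ℝ → ℝ) (p : ℝ[X]) : Prop where
  natDegree_le : p.natDegree ≤ r
  eq : ∀ v : ℝ[X], v.natDegree ≤ r →
    (∫ s in a..b, (derivative p).eval s * v.eval s) + (p.eval a - w) * v.eval a
      + lam * (∫ s in a..b, p.eval s * v.eval s) = ∫ s in a..b, g s * v.eval s

lemma mem_polySpace_top_iff {r : ℕ} {p : ℝ → ℝ} : p ∈ polySpace (⊤ : Submodule ℝ ℝ) r ↔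
    ∃ q : ℝ[X], q.natDegree ≤ r ∧ p = fun t => q.eval t := by
  constructor
  · rintro ⟨c, -, hc⟩
    refine ⟨∑ i ∈ Finset.range (r + 1), monomial i (c i), ?_, funext fun t => ?_⟩
    · exact natDegree_sum_le_of_forall_le _ _ fun i hi =>
        (natDegree_monomial_le _).trans (Nat.lt_succ_iff.1 (Finset.mem_range.1 hi))
    · simp [hc, eval_finsetSum, mul_comm]
  · rintro ⟨q, hq, rfl⟩
    exact ⟨q.coeff, fun _ => trivial, fun t => by
      simp [eval_eq_sum_range' (Nat.lt_succ_of_le hq), mul_comm]⟩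

lemma IsScalarStep.isFundamentalSolution {a b lam : ℝ} {r : ℕ} {p : ℝ[X]}
    (h : IsScalarStep a b lam r 1 0 p) : IsFundamentalSolution a b lam r fun t => p.eval t := by
  refine ⟨mem_polySpace_top_iff.2 ⟨p, h.natDegree_le, rfl⟩, fun Φ hΦ => ?_⟩
  obtain ⟨v, hv, rfl⟩ := mem_polySpace_top_iff.1 hΦ
  have e := h.eq v hv
  have hin : ∀ x y : ℝ, ⟪x, y⟫_ℝ = x * y := fun x y => by simp [mul_comm]
  have hsc : ∀ x y : ℝ, scalarOp lam x y = lam * (x * y) := fun x y => by simp [scalarOp]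
  simpa only [hin, hsc, ContinuousLinearMap.id_apply, intervalIntegral.integral_const_mul,
    Polynomial.deriv] using e

/-- The defect `(∑_j (-lam)^(-j) Θ^(j)(a))⁻¹` of the dG fundamental solution at the left endpoint,
where `Θ` is the Radau polynomial of degree `r + 1` on `[a, b]`. -/
def fundDefect (a b lam : ℝ) (r : ℕ) : ℝ :=
  (1 + ∑ j ∈ Finset.range (r + 1),
    (-lam)⁻¹ ^ (j + 1) * (derivative^[j + 1] (radauOn a b (r + 1))).eval a)⁻¹

/-- The dG fundamental solution as a combination of the derivatives of the Radau polynomial. -/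
def fundPoly (a b lam : ℝ) (r : ℕ) : ℝ[X] :=
  C (fundDefect a b lam r) * ∑ j ∈ Finset.range (r + 1),
    C ((-lam)⁻¹ ^ (j + 1)) * derivative^[j + 1] (radauOn a b (r + 1))

/-- The alternating signs at `a` turn the sum in `fundDefect` into one with nonnegative terms. -/
lemma fund_term_left {a b : ℝ} (hab : a < b) (lam : ℝ) (n j : ℕ) :
    (-lam)⁻¹ ^ j * (derivative^[j] (radauOn a b n)).eval a =
      lam⁻¹ ^ j * |(derivative^[j] (radauOn a b n)).eval a| := by
  rw [abs_radauOn_left hab, inv_neg, neg_pow]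
  ring

section Fundamental

variable {a b lam : ℝ} (hab : a < b) (hlam : 0 < lam) (r : ℕ)
include hab hlam

lemma one_le_inv_fundDefect : 1 ≤ (fundDefect a b lam r)⁻¹ := by
  rw [fundDefect, inv_inv]
  simp only [fund_term_left hab]
  exact le_add_of_nonneg_right (Finset.sum_nonneg fun j _ => by positivity)

lemma fundDefect_pos : 0 < fundDefect a b lam r :=
  inv_pos.1 (zero_lt_one.trans_le (one_le_inv_fundDefect hab hlam r))

lemma fundPoly_eval_left : (fundPoly a b lam r).eval a = 1 - fundDefect a b lam r := by
  have h := fundDefect_pos hab hlam r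
  have e : ∑ j ∈ Finset.range (r + 1),
      (-lam)⁻¹ ^ (j + 1) * (derivative^[j + 1] (radauOn a b (r + 1))).eval a =
      (fundDefect a b lam r)⁻¹ - 1 := by
    rw [fundDefect, inv_inv]; ring
  simp only [fundPoly, eval_mul, eval_C, eval_finsetSum, e]
  rw [mul_sub, mul_inv_cancel₀ h.ne', mul_one]

/-- The dG fundamental solution is bounded by `1`: every derivative of the Radau polynomial has its
largest modulus at `a`, where the terms of `fundPoly` are all nonnegative. -/
lemma abs_fundPoly_le {t : ℝ} (ht : t ∈ Set.Icc a b) : |(fundPoly a b lam r).eval t| ≤ 1 := by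
  have h := fundDefect_pos hab hlam r
  refine le_trans ?_ (show (fundPoly a b lam r).eval a ≤ 1 by
    rw [fundPoly_eval_left hab hlam]; linarith)
  simp only [fundPoly, eval_mul, eval_C, eval_finsetSum]
  rw [abs_mul, abs_of_pos h]
  gcongr
  refine (Finset.abs_sum_le_sum_abs _ _).trans (Finset.sum_le_sum fun j _ => ?_)
  rw [fund_term_left hab, abs_mul, abs_pow, abs_inv, abs_neg, abs_of_pos hlam]
  exact mul_le_mul_of_nonneg_left (abs_radauOn_le hab (Nat.succ_pos r) _ ht) (by positivity)

omit hab in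
/-- The strong form of the scheme for the fundamental solution. The sum telescopes, and the derivative
of order `r + 2` of the Radau polynomial of degree `r + 1` vanishes. -/
lemma derivative_fundPoly : derivative (fundPoly a b lam r) + C lam * fundPoly a b lam r =
    -C (fundDefect a b lam r) * derivative (radauOn a b (r + 1)) := by
  have hz : derivative^[r + 2] (radauOn a b (r + 1)) = 0 :=
    iterate_derivative_eq_zero ((natDegree_radauOn_le a b (r + 1)).trans_lt (Nat.lt_succ_self _))
  set u : ℕ → ℝ[X] := fun j => C ((-lam)⁻¹ ^ j) * derivative^[j + 1] (radauOn a b (r + 1)) with hu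
  have e : ∀ j, derivative (C ((-lam)⁻¹ ^ (j + 1)) * derivative^[j + 1] (radauOn a b (r + 1)))
      + C lam * (C ((-lam)⁻¹ ^ (j + 1)) * derivative^[j + 1] (radauOn a b (r + 1))) =
      u (j + 1) - u j := fun j => by
    have : C lam * C ((-lam)⁻¹ ^ (j + 1)) = -C ((-lam)⁻¹ ^ j) := by
      rw [← C_mul, ← C_neg]
      congr 1
      rw [pow_succ, inv_neg]
      field_simp
    rw [derivative_C_mul, ← Function.iterate_succ_apply' derivative, ← mul_assoc, this]
    simp only [hu]
    ring
  have hsum : (∑ j ∈ Finset.range (r + 1),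
      derivative (C ((-lam)⁻¹ ^ (j + 1)) * derivative^[j + 1] (radauOn a b (r + 1))))
      + C lam * ∑ j ∈ Finset.range (r + 1),
        C ((-lam)⁻¹ ^ (j + 1)) * derivative^[j + 1] (radauOn a b (r + 1)) =
      -derivative (radauOn a b (r + 1)) := by
    rw [Finset.mul_sum, ← Finset.sum_add_distrib, Finset.sum_congr rfl fun j _ => e j,
      Finset.sum_range_sub]
    simp only [hu, hz, mul_zero, pow_zero, map_one, one_mul, zero_sub, zero_add,
      Function.iterate_one]
  rw [fundPoly, derivative_C_mul, derivative_sum]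
  linear_combination C (fundDefect a b lam r) * hsum

lemma isScalarStep_fundPoly : IsScalarStep a b lam r 1 0 (fundPoly a b lam r) := by
  refine ⟨?_, fun v hv => ?_⟩
  · refine (natDegree_C_mul_le _ _).trans (natDegree_sum_le_of_forall_le _ _ fun j _ =>
      (natDegree_C_mul_le _ _).trans ?_)
    have := natDegree_iterate_derivative_radauOn_le a b (r + 1) (j + 1)
    omega
  · have e : ∀ s, (derivative (fundPoly a b lam r)).eval s * v.eval s
        + lam * ((fundPoly a b lam r).eval s * v.eval s) = -fundDefect a b lam r *
          ((derivative (radauOn a b (r + 1))).eval s * v.eval s) := fun s => by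
      have := congrArg (eval s) (derivative_fundPoly (a := a) (b := b) hlam r)
      simp only [eval_add, eval_mul, eval_C, eval_neg] at this
      linear_combination v.eval s * this
    have hI : (∫ s in a..b, (derivative (fundPoly a b lam r)).eval s * v.eval s)
        + lam * (∫ s in a..b, (fundPoly a b lam r).eval s * v.eval s)
        = fundDefect a b lam r * v.eval a := by
      rw [← intervalIntegral.integral_const_mul, ← intervalIntegral.integral_add
        (Continuous.intervalIntegrable (by fun_prop) _ _)
        (Continuous.intervalIntegrable (by fun_prop) _ _)]
      simp only [e]
      rw [intervalIntegral.integral_const_mul,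
        integral_derivative_radauOn_mul hab (Nat.lt_succ_of_le hv)]
      ring
    rw [fundPoly_eval_left hab hlam]
    simp only [Pi.zero_apply, zero_mul, intervalIntegral.integral_zero]
    linarith

lemma fundamentalSolution_eq : fundamentalSolution a b lam r =
    fun t => (fundPoly a b lam r).eval t :=
  (existsUnique_fundamentalSolution hab hlam r).unique (fundamentalSolution_spec hab hlam r)
    (isScalarStep_fundPoly hab hlam r).isFundamentalSolution

lemma fundamentalError_left : fundamentalError a b lam r a = fundDefect a b lam r := by
  simp [fundamentalError, fundamentalSolution_eq hab hlam, fundPoly_eval_left hab hlam]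

/-- The normalized error solves `y' + lam y = Θ'` with `Θ` the Radau polynomial. -/
lemma hasDerivAt_errorRatio (t : ℝ) :
    HasDerivAt (fun t => fundamentalError a b lam r t / fundamentalError a b lam r a)
      ((derivative (radauOn a b (r + 1))).eval t
        - lam * (fundamentalError a b lam r t / fundamentalError a b lam r a)) t := by
  have h0 := fundDefect_pos hab hlam r
  have h1 : HasDerivAt (fun s => Real.exp (-lam * (s - a)))
      (Real.exp (-lam * (t - a)) * -lam) t := by
    have := (((hasDerivAt_id t).sub_const a).const_mul (-lam)).exp
    simpa using this
  have h2 := (h1.sub ((fundPoly a b lam r).hasDerivAt t)).div_const (fundDefect a b lam r)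
  have e := congrArg (eval t) (derivative_fundPoly (a := a) (b := b) hlam r)
  simp only [eval_add, eval_mul, eval_C, eval_neg] at e
  rw [fundamentalError_left hab hlam]
  simp only [fundamentalError, fundamentalSolution_eq hab hlam]
  refine h2.congr_deriv ?_
  field_simp
  linarith

lemma errorRatio_left : fundamentalError a b lam r a / fundamentalError a b lam r a = 1 :=
  div_self (by rw [fundamentalError_left hab hlam]; exact (fundDefect_pos hab hlam r).ne')

lemma continuous_errorRatio :
    Continuous fun t => fundamentalError a b lam r t / fundamentalError a b lam r a :=
  continuous_iff_continuousAt.2 fun t => (hasDerivAt_errorRatio hab hlam r t).continuousAt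

/-- With `Θ` the Radau polynomial and `h` the difference of the normalized error and `Θ`,
`(e^{lam t} (1 ± h))' = lam e^{lam t} (1 ∓ Θ) ≥ 0`, so that `|h| ≤ 1`, while `|Θ| ≤ 1`. -/
lemma abs_errorRatio_le {t : ℝ} (ht : t ∈ Set.Icc a b) :
    |fundamentalError a b lam r t / fundamentalError a b lam r a| ≤ 2 := by
  set g := fun t => fundamentalError a b lam r t / fundamentalError a b lam r a with hg
  have hΘ : ∀ s ∈ Set.Icc a b, |(radauOn a b (r + 1)).eval s| ≤ 1 := fun s hs => by
    have := abs_radauOn_le hab (Nat.succ_pos r) 0 hs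
    simpa [radauOn_eval_left] using this
  have hE : ∀ s, HasDerivAt (fun s => Real.exp (lam * s)) (Real.exp (lam * s) * lam) s := fun s => by
    have := ((hasDerivAt_id s).const_mul lam).exp
    simpa using this
  have key : ∀ σ : ℝ, |σ| = 1 → 0 ≤ 1 + σ * (g t - (radauOn a b (r + 1)).eval t) := by
    intro σ hσ
    set p := fun s => Real.exp (lam * s) * (1 + σ * (g s - (radauOn a b (r + 1)).eval s)) with hp
    have hd : ∀ s, HasDerivAt p
        (lam * Real.exp (lam * s) * (1 - σ * (radauOn a b (r + 1)).eval s)) s := fun s => by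
      have h := (hE s).mul ((((hasDerivAt_errorRatio hab hlam r s).sub
        ((radauOn a b (r + 1)).hasDerivAt s)).const_mul σ).const_add 1)
      refine h.congr_deriv ?_
      simp only [Pi.sub_apply]
      ring
    have hmono : MonotoneOn p (Set.Icc a b) := by
      refine monotoneOn_of_deriv_nonneg (convex_Icc a b)
        (fun s _ => (hd s).continuousAt.continuousWithinAt)
        (fun s _ => (hd s).differentiableAt.differentiableWithinAt) fun s hs => ?_
      rw [(hd s).deriv]
      have h1 := hΘ s (interior_subset hs)
      have h2 : |σ * (radauOn a b (r + 1)).eval s| ≤ 1 := by rwa [abs_mul, hσ, one_mul]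
      have := (abs_le.1 h2).2
      exact mul_nonneg (by positivity) (by linarith)
    have h := hmono (Set.left_mem_Icc.2 hab.le) ht ht.1
    have ha : p a = Real.exp (lam * a) := by
      simp only [hp, hg, errorRatio_left hab hlam, radauOn_eval_left]
      ring
    rw [ha] at h
    exact (pos_of_mul_pos_right ((Real.exp_pos _).trans_le h) (Real.exp_pos _).le).le
  have h1 := key 1 (by simp)
  have h2 := key (-1) (by simp)
  have h3 := abs_le.1 (hΘ t ht)
  exact abs_le.2 ⟨by linarith, by linarith⟩

lemma eLpNorm_errorRatio_le :
    eLpNorm (fun t => fundamentalError a b lam r t / fundamentalError a b lam r a) ∞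
      (volume.restrict (Set.Ioc a b)) ≤ 2 := by
  rw [eLpNorm_exponent_top]
  refine (eLpNormEssSup_le_of_ae_bound (C := 2) ?_).trans (by simp)
  rw [ae_restrict_iff' measurableSet_Ioc]
  exact ae_of_all _ fun t ht => abs_errorRatio_le hab hlam r (Set.Ioc_subset_Icc_self ht)

lemma abs_errorRatio_le_eLpNorm {t : ℝ} (ht : t ∈ Set.Icc a b) :
    |fundamentalError a b lam r t / fundamentalError a b lam r a| ≤
      (eLpNorm (fun t => fundamentalError a b lam r t / fundamentalError a b lam r a) ∞
        (volume.restrict (Set.Ioc a b))).toReal := by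
  refine abs_le_of_ae_restrict_Ioc (continuous_errorRatio hab hlam r) hab ?_ ht
  have hfin := ((eLpNorm_errorRatio_le hab hlam r).trans_lt ENNReal.ofNat_lt_top).ne
  simp only [eLpNorm_exponent_top] at hfin ⊢
  filter_upwards [ae_le_eLpNormEssSup (μ := volume.restrict (Set.Ioc a b))
    (f := fun t => fundamentalError a b lam r t / fundamentalError a b lam r a)] with s hs
  have := ENNReal.toReal_mono hfin hs
  rwa [toReal_enorm, Real.norm_eq_abs] at this

lemma scalarConst_le : scalarConst a b lam r ≤ 1 + 2 * √(3 / (2 * (2 * (r : ℝ) + 1))) := by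
  have h1 : (eLpNorm (fun t => fundamentalError a b lam r t / fundamentalError a b lam r a) ∞
      (volume.restrict (Set.Ioc a b))).toReal ≤ 2 :=
    ENNReal.toReal_le_of_le_ofReal (by norm_num)
      ((eLpNorm_errorRatio_le hab hlam r).trans (by simp))
  have h2 : upsilon r ((b - a) * lam) ≤ √(3 / (2 * (2 * (r : ℝ) + 1))) := by
    refine Real.sqrt_le_sqrt ?_
    gcongr
    exact le_add_of_nonneg_right (mul_nonneg (sub_pos.2 hab).le hlam.le)
  rw [scalarConst, add_comm, mul_comm]
  gcongr
  exact Real.sqrt_nonneg _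

end Fundamental

lemma one_le_scalarConst (a b lam : ℝ) (r : ℕ) : 1 ≤ scalarConst a b lam r :=
  le_add_of_nonneg_left (mul_nonneg (Real.sqrt_nonneg _) ENNReal.toReal_nonneg)

namespace IsScalarStep

variable {a b lam : ℝ} {r : ℕ} {g : ℝ → ℝ} {z : ℝ[X]}

lemma sub_fundPoly (hab : a < b) (hlam : 0 < lam) {w : ℝ} (h : IsScalarStep a b lam r w g z) :
    IsScalarStep a b lam r 0 g (z - C w * fundPoly a b lam r) := by
  have h0 := isScalarStep_fundPoly hab hlam r
  refine ⟨(natDegree_sub_le _ _).trans (max_le h.natDegree_le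
    ((natDegree_C_mul_le _ _).trans h0.natDegree_le)), fun v hv => ?_⟩
  have e1 := h.eq v hv
  have e2 := h0.eq v hv
  simp only [Pi.zero_apply, zero_mul, intervalIntegral.integral_zero] at e2
  simp only [derivative_sub, derivative_C_mul, eval_sub, eval_mul, eval_C, sub_mul, mul_assoc]
  rw [intervalIntegral.integral_sub, intervalIntegral.integral_sub,
    intervalIntegral.integral_const_mul, intervalIntegral.integral_const_mul]
  · linear_combination e1 - w * e2
  all_goals exact Continuous.intervalIntegrable (by fun_prop) _ _

/-- The bound of the initial value comes from testing with the Legendre polynomial `L` of degree `r`,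
which gives `z(a) = ∫ (g - lam z) L`, and from the energy identity, which gives
`‖g - lam z‖² ≤ ‖g‖² - lam z(a)²`. -/
lemma eval_left_sq_le (hab : a < b) (hlam : 0 < lam)
    (hg : MemLp g 2 (volume.restrict (Set.Ioc a b))) (h : IsScalarStep a b lam r 0 g z) :
    (2 * r + 1 + (b - a) * lam) * z.eval a ^ 2 ≤ (b - a) * ∫ s in a..b, g s ^ 2 := by
  have hz := memLp_Ioc_of_continuous z.continuous a b
  have hL := memLp_Ioc_of_continuous (legendreOn a b r).continuous a b
  have ii : ∀ {u : ℝ → ℝ}, Integrable u (volume.restrict (Set.Ioc a b)) →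
      IntervalIntegrable u volume a b := fun hu =>
    (intervalIntegrable_iff_integrableOn_Ioc_of_le hab.le).2 hu
  have hgz : IntervalIntegrable (fun s => g s * z.eval s) volume a b := ii (hg.integrable_mul hz)
  have hgL : IntervalIntegrable (fun s => g s * (legendreOn a b r).eval s) volume a b :=
    ii (hg.integrable_mul hL)
  have hg2 := ii hg.integrable_sq
  -- Testing with the Legendre polynomial.
  have e1 : z.eval a = ∫ s in a..b, (g s - lam * z.eval s) * (legendreOn a b r).eval s := by
    have e := h.eq _ (natDegree_legendreOn_le a b r)
    rw [integral_legendreOn_mul_derivative hab h.natDegree_le, legendreOn_eval_left hab] at e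
    simp only [sub_mul, mul_assoc]
    rw [intervalIntegral.integral_sub hgL (Continuous.intervalIntegrable (by fun_prop) _ _),
      intervalIntegral.integral_const_mul]
    linarith
  -- Testing with the solution itself.
  have e2 : lam * z.eval a ^ 2 + ∫ s in a..b, (g s - lam * z.eval s) ^ 2
      ≤ ∫ s in a..b, g s ^ 2 := by
    have e := h.eq z h.natDegree_le
    have hparts : ∫ s in a..b, (derivative z).eval s * z.eval s
        = (z.eval b ^ 2 - z.eval a ^ 2) / 2 := by
      have hd := integral_derivative_eval (z ^ 2) a b
      simp only [derivative_pow, Nat.cast_ofNat, eval_mul, eval_C, Nat.add_one_sub_one, pow_one,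
        eval_pow] at hd
      simp only [mul_assoc, intervalIntegral.integral_const_mul] at hd
      simp only [mul_comm ((derivative z).eval _)]
      linarith
    have hz2 : (0 : ℝ) ≤ ∫ s in a..b, z.eval s * z.eval s :=
      intervalIntegral.integral_nonneg hab.le fun s _ => mul_self_nonneg _
    have ee : ∀ s, (g s - lam * z.eval s) ^ 2 =
        g s ^ 2 - (2 * lam) * (g s * z.eval s) + lam ^ 2 * (z.eval s * z.eval s) := fun s => by ring
    simp only [ee]
    rw [intervalIntegral.integral_add (hg2.sub (hgz.const_mul _))
      (Continuous.intervalIntegrable (by fun_prop) _ _),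
      intervalIntegral.integral_sub hg2 (hgz.const_mul _), intervalIntegral.integral_const_mul,
      intervalIntegral.integral_const_mul]
    rw [← e, hparts]
    nlinarith [mul_nonneg (sq_nonneg lam) hz2, mul_nonneg hlam.le (sq_nonneg (z.eval b))]
  have e3 := sq_integral_mul_le (hg.sub (hz.const_mul lam)) hL
  simp only [Pi.sub_apply] at e3
  rw [← intervalIntegral.integral_of_le hab.le, ← intervalIntegral.integral_of_le hab.le,
    ← intervalIntegral.integral_of_le hab.le, ← e1, integral_legendreOn_sq hab] at e3
  have hr : (0 : ℝ) < 2 * r + 1 := by positivity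
  rw [mul_div_assoc', le_div_iff₀ hr] at e3
  nlinarith [mul_le_mul_of_nonneg_left e2 (sub_pos.2 hab).le]

/-- The scalar stability estimate for a vanishing incoming value. In strong form, the step reads
`z' + lam z = F + z(a) Θ'` with `F` the `L²`-projection of `g` and `Θ` the Radau polynomial. So `z` is
`z(a)` times the normalized error of the fundamental solution plus the solution `y` of
`y' + lam y = F`, `y(a) = 0`. -/
lemma abs_eval_le (hab : a < b) (hlam : 0 < lam)
    (hg : MemLp g 2 (volume.restrict (Set.Ioc a b))) (h : IsScalarStep a b lam r 0 g z) {t : ℝ}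
    (ht : t ∈ Set.Icc a b) :
    |z.eval t| ≤ scalarConst a b lam r * √(b - a) * √(∫ s in a..b, g s ^ 2) := by
  have hk : 0 < b - a := sub_pos.2 hab
  set F : ℝ[X] := derivative z + C lam * z - C (z.eval a) * derivative (radauOn a b (r + 1)) with hF
  have hFdeg : F.natDegree ≤ r := by
    refine (natDegree_sub_le _ _).trans (max_le ((natDegree_add_le _ _).trans (max_le ?_ ?_)) ?_)
    · exact (natDegree_derivative_le z).trans ((Nat.sub_le _ _).trans h.natDegree_le)
    · exact (natDegree_C_mul_le _ _).trans h.natDegree_le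
    · refine (natDegree_C_mul_le _ _).trans ?_
      simpa using natDegree_iterate_derivative_radauOn_le a b (r + 1) 1
  have hFm := memLp_Ioc_of_continuous F.continuous a b
  have hFg : ∫ s in a..b, F.eval s ^ 2 = ∫ s in a..b, g s * F.eval s := by
    have e := h.eq F hFdeg
    have ee : ∀ s, F.eval s ^ 2 = (derivative z).eval s * F.eval s + lam * (z.eval s * F.eval s)
        - z.eval a * ((derivative (radauOn a b (r + 1))).eval s * F.eval s) := fun s => by
      rw [sq]
      nth_rewrite 1 [hF]
      simp only [eval_add, eval_sub, eval_mul, eval_C]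
      ring
    simp only [ee]
    rw [intervalIntegral.integral_sub, intervalIntegral.integral_add,
      intervalIntegral.integral_const_mul, intervalIntegral.integral_const_mul,
      integral_derivative_radauOn_mul hab (Nat.lt_succ_of_le hFdeg), ← e]
    · ring
    all_goals exact Continuous.intervalIntegrable (by fun_prop) _ _
  have hF0 : 0 ≤ ∫ s in a..b, F.eval s ^ 2 :=
    intervalIntegral.integral_nonneg hab.le fun s _ => sq_nonneg _
  have hg0 : 0 ≤ ∫ s in a..b, g s ^ 2 :=
    intervalIntegral.integral_nonneg hab.le fun s _ => sq_nonneg _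
  have hFle : ∫ s in a..b, F.eval s ^ 2 ≤ ∫ s in a..b, g s ^ 2 := by
    have hcs := sq_integral_mul_le hg hFm
    rw [← intervalIntegral.integral_of_le hab.le, ← intervalIntegral.integral_of_le hab.le,
      ← intervalIntegral.integral_of_le hab.le, ← hFg, sq] at hcs
    rcases hF0.eq_or_lt with h0 | h0
    · rw [← h0]; exact hg0
    · exact le_of_mul_le_mul_right hcs h0
  -- The solution `y` of `y' + lam y = F`, `y(a) = 0`.
  have hy : |z.eval t - z.eval a * (fundamentalError a b lam r t / fundamentalError a b lam r a)| ≤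
      √(b - a) * √(∫ s in a..b, g s ^ 2) := by
    refine (abs_le_integral_of_ode (F := fun s => F.eval s)
      (y := fun t => z.eval t
        - z.eval a * (fundamentalError a b lam r t / fundamentalError a b lam r a))
      hlam.le ht.1 F.continuous (fun s => ?_) ?_).trans ?_
    · refine ((z.hasDerivAt s).sub
        ((hasDerivAt_errorRatio hab hlam r s).const_mul (z.eval a))).congr_deriv ?_
      simp only [hF, eval_add, eval_sub, eval_mul, eval_C]
      ring
    · simp only [errorRatio_left hab hlam]
      ring
    · have h1 : ∫ s in a..t, |F.eval s| ≤ ∫ s in a..b, |F.eval s| :=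
        intervalIntegral.integral_mono_interval le_rfl ht.1 ht.2
          (ae_of_all _ fun _ => abs_nonneg _) (Continuous.intervalIntegrable (by fun_prop) _ _)
      have h2 := sq_integral_mul_le (memLp_Ioc_of_continuous (continuous_const (y := (1 : ℝ))) a b)
        (memLp_Ioc_of_continuous F.continuous.abs a b)
      simp only [one_mul, one_pow, sq_abs] at h2
      rw [← intervalIntegral.integral_of_le hab.le, ← intervalIntegral.integral_of_le hab.le,
        ← intervalIntegral.integral_of_le hab.le] at h2
      simp only [intervalIntegral.integral_const, smul_eq_mul, mul_one] at h2
      refine h1.trans ?_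
      rw [← Real.sqrt_mul hk.le]
      exact Real.le_sqrt_of_sq_le (h2.trans (by gcongr))
  have hza : |z.eval a| ≤ upsilon r ((b - a) * lam) * (√(b - a) * √(∫ s in a..b, g s ^ 2)) := by
    have h1 := h.eval_left_sq_le hab hlam hg
    have hr : (0 : ℝ) ≤ r := Nat.cast_nonneg r
    have hkl : 0 < (b - a) * lam := mul_pos hk hlam
    have hpos : 0 < 2 * (2 * (r : ℝ) + 1) + (b - a) * lam := by positivity
    rw [upsilon, ← Real.sqrt_mul hk.le, ← Real.sqrt_mul (by positivity)]
    refine Real.le_sqrt_of_sq_le ?_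
    rw [sq_abs, div_mul_eq_mul_div, le_div_iff₀ hpos]
    nlinarith [mul_nonneg hkl.le (sq_nonneg (z.eval a)), mul_nonneg hk.le hg0]
  set G := (eLpNorm (fun t => fundamentalError a b lam r t / fundamentalError a b lam r a) ∞
        (volume.restrict (Set.Ioc a b))).toReal with hG
  have hGt := abs_errorRatio_le_eLpNorm hab hlam r ht
  rw [← hG] at hGt
  have hm : |z.eval a * (fundamentalError a b lam r t / fundamentalError a b lam r a)| ≤
      upsilon r ((b - a) * lam) * (√(b - a) * √(∫ s in a..b, g s ^ 2)) * G := by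
    rw [abs_mul]
    exact mul_le_mul hza hGt (abs_nonneg _) ((abs_nonneg _).trans hza)
  have htri := abs_sub_abs_le_abs_sub (z.eval t)
    (z.eval a * (fundamentalError a b lam r t / fundamentalError a b lam r a))
  rw [scalarConst, ← hG]
  linarith

end IsScalarStep

/-- The homogeneous problem has only the trivial solution, by `IsScalarStep.abs_eval_le`, and the
trial and test spaces coincide and have finite dimension. -/
lemma exists_isScalarStep {a b lam : ℝ} (hab : a < b) (hlam : 0 < lam) (r : ℕ) (w : ℝ) {g : ℝ → ℝ}
    (hg : MemLp g 2 (volume.restrict (Set.Ioc a b))) : ∃ p, IsScalarStep a b lam r w g p := by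
  have hmem : ∀ v : ℝ[X], v ∈ degreeLT ℝ (r + 1) ↔ v.natDegree ≤ r := fun v => by
    rw [mem_degreeLT, degree_lt_iff_coeff_zero, natDegree_le_iff_coeff_eq_zero]
    rfl
  have : FiniteDimensional ℝ (degreeLT ℝ (r + 1)) :=
    Module.Finite.equiv (degreeLTEquiv ℝ (r + 1)).symm
  let form (u v : ℝ[X]) : ℝ := (∫ s in a..b, (derivative u).eval s * v.eval s)
    + u.eval a * v.eval a + lam * (∫ s in a..b, u.eval s * v.eval s)
  have ic : ∀ u v : ℝ[X], IntervalIntegrable (fun s => u.eval s * v.eval s) volume a b :=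
    fun u v => Continuous.intervalIntegrable (by fun_prop) _ _
  have ig : ∀ v : ℝ[X], IntervalIntegrable (fun s => g s * v.eval s) volume a b := fun v =>
    (intervalIntegrable_iff_integrableOn_Ioc_of_le hab.le).2
      (hg.integrable_mul (memLp_Ioc_of_continuous v.continuous a b))
  let T : degreeLT ℝ (r + 1) →ₗ[ℝ] Module.Dual ℝ (degreeLT ℝ (r + 1)) :=
    LinearMap.mk₂ ℝ (fun u v => form u v)
    (fun u u' v => by
      simp only [form, Submodule.coe_add, derivative_add, eval_add, add_mul]
      rw [intervalIntegral.integral_add (ic _ _) (ic _ _),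
        intervalIntegral.integral_add (ic _ _) (ic _ _)]
      ring)
    (fun k u v => by
      simp only [form, Submodule.coe_smul, derivative_smul, eval_smul, smul_eq_mul, mul_assoc,
        intervalIntegral.integral_const_mul]
      ring)
    (fun u v v' => by
      simp only [form, Submodule.coe_add, eval_add, mul_add]
      rw [intervalIntegral.integral_add (ic _ _) (ic _ _),
        intervalIntegral.integral_add (ic _ _) (ic _ _)]
      ring)
    (fun k u v => by
      simp only [form, Submodule.coe_smul, eval_smul, smul_eq_mul, mul_left_comm _ k,
        intervalIntegral.integral_const_mul]
      ring)
  have hT : ∀ u v : degreeLT ℝ (r + 1), T u v = form u v := fun u v => rfl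
  have hinj : Function.Injective T := by
    rw [injective_iff_map_eq_zero]
    intro u hu
    have hstep : IsScalarStep a b lam r 0 0 (u : ℝ[X]) := by
      refine ⟨(hmem u).1 u.2, fun v hv => ?_⟩
      have h := hT u ⟨v, (hmem v).2 hv⟩
      rw [hu, LinearMap.zero_apply] at h
      simp only [Pi.zero_apply, zero_mul, intervalIntegral.integral_zero, sub_zero]
      exact h.symm
    refine Subtype.ext (eq_zero_of_infinite_isRoot _ ((Set.Icc_infinite hab).mono fun s hs => ?_))
    have := hstep.abs_eval_le hab hlam MemLp.zero hs
    simpa using this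
  have hsurj : Function.Surjective T :=
    (LinearMap.injective_iff_surjective_of_finrank_eq_finrank
      (Subspace.dual_finrank_eq (K := ℝ) (V := degreeLT ℝ (r + 1))).symm).1 hinj
  let R : Module.Dual ℝ (degreeLT ℝ (r + 1)) :=
    { toFun := fun v => w * (v : ℝ[X]).eval a + ∫ s in a..b, g s * (v : ℝ[X]).eval s
      map_add' := fun v v' => by
        simp only [Submodule.coe_add, eval_add, mul_add]
        rw [intervalIntegral.integral_add (ig _) (ig _)]
        ring
      map_smul' := fun k v => by
        simp only [Submodule.coe_smul, eval_smul, smul_eq_mul, mul_left_comm _ k,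
          intervalIntegral.integral_const_mul, RingHom.id_apply]
        ring }
  obtain ⟨u, hu⟩ := hsurj R
  refine ⟨u, (hmem u).1 u.2, fun v hv => ?_⟩
  have h := hT u ⟨v, (hmem v).2 hv⟩
  rw [hu] at h
  simp only [R, form, LinearMap.coe_mk, AddHom.coe_mk] at h
  linear_combination -h

lemma IsScalarStep.unique {a b lam : ℝ} (hab : a < b) (hlam : 0 < lam) {r : ℕ} {w : ℝ} {g : ℝ → ℝ}
    {p q : ℝ[X]} (hp : IsScalarStep a b lam r w g p) (hq : IsScalarStep a b lam r w g q) :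
    p = q := by
  have h : IsScalarStep a b lam r 0 0 (p - q) := by
    refine ⟨(natDegree_sub_le _ _).trans (max_le hp.natDegree_le hq.natDegree_le), fun v hv => ?_⟩
    have e1 := hp.eq v hv
    have e2 := hq.eq v hv
    simp only [Pi.zero_apply, zero_mul, intervalIntegral.integral_zero, derivative_sub, eval_sub,
      sub_mul]
    rw [intervalIntegral.integral_sub, intervalIntegral.integral_sub]
    · linear_combination e1 - e2
    all_goals exact Continuous.intervalIntegrable (by fun_prop) _ _
  refine sub_eq_zero.1 (eq_zero_of_infinite_isRoot _ ((Set.Icc_infinite hab).mono fun s hs => ?_))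
  have := h.abs_eval_le hab hlam MemLp.zero hs
  simpa using this

/-! ### Decoupling of a dG step in an eigenbasis -/

section Step

variable {X H : Type*} [NormedAddCommGroup X] [InnerProductSpace ℝ X]
  [NormedAddCommGroup H] [InnerProductSpace ℝ H]

/-- A basis of `V` consisting of eigenvectors of `A_V`, orthonormal in `H`. -/
structure IsEigenbasis (ι : X →L[ℝ] H) (hι : Function.Injective ι) (A : X →L[ℝ] StrongDual ℝ X)
    (V : Submodule ℝ X) [FiniteDimensional ℝ V] {n : ℕ} (B : Module.Basis (Fin n) ℝ V)
    (lam : Fin n → ℝ) : Prop where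
  orthonormal : Orthonormal ℝ fun j => ι (B j : X)
  apply_eq : ∀ j, discreteEnd ι hι A V (B j) = lam j • B j

lemma exists_isEigenbasis (ι : X →L[ℝ] H) (hι : Function.Injective ι) (A : X →L[ℝ] StrongDual ℝ X)
    (hA : ∀ v w : X, A v w = A w v) (V : Submodule ℝ X) [FiniteDimensional ℝ V] :
    ∃ (n : ℕ) (B : Module.Basis (Fin n) ℝ V) (lam : Fin n → ℝ), IsEigenbasis ι hι A V B lam := by
  -- The operator is transported to the image of `V` in `H`, where it is symmetric.
  let W := V.map ι.toLinearMap
  let e : V ≃ₗ[ℝ] W := Submodule.equivMapOfInjective ι.toLinearMap hι V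
  have he : ∀ v : V, ((e v : W) : H) = ι (v : X) := fun v => rfl
  have : FiniteDimensional ℝ W := Module.Finite.equiv e
  let S : W →ₗ[ℝ] W := e.toLinearMap ∘ₗ discreteEnd ι hι A V ∘ₗ e.symm.toLinearMap
  have hS : S.IsSymmetric := by
    intro x y
    obtain ⟨u, rfl⟩ := e.surjective x
    obtain ⟨v, rfl⟩ := e.surjective y
    simp only [S, LinearMap.comp_apply, LinearEquiv.coe_coe, LinearEquiv.symm_apply_apply,
      Submodule.coe_inner, he, discreteEnd, Submodule.coe_subtype]
    rw [inner_discreteOp, real_inner_comm, inner_discreteOp, hA]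
  let E := hS.eigenvectorBasis (n := Module.finrank ℝ W) rfl
  refine ⟨_, E.toBasis.map e.symm, hS.eigenvalues rfl, ?_, fun j => ?_⟩
  · have h := E.orthonormal
    rw [orthonormal_iff_ite] at h ⊢
    intro i j
    rw [← h i j, Submodule.coe_inner, ← he, ← he]
    simp
  · have h := hS.apply_eigenvectorBasis rfl j
    apply e.injective
    rw [Module.Basis.map_apply, OrthonormalBasis.coe_toBasis, map_smul, e.apply_symm_apply]
    exact h

lemma eigenvalue_pos {ι : X →L[ℝ] H} (hι : Function.Injective ι) {A : X →L[ℝ] StrongDual ℝ X}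
    {α : ℝ} (hα : 0 < α) (hA : ∀ v : X, α * ‖v‖ ^ 2 ≤ A v v)
    {V : Submodule ℝ X} [FiniteDimensional ℝ V] {μ : ℝ}
    (hμ : (discreteEnd ι hι A V).HasEigenvalue μ) : 0 < μ := by
  obtain ⟨v, hv⟩ := hμ.exists_hasEigenvector
  have h := inner_discreteOp ι hι A V v v
  have hv' : discreteOp ι hι A V v = μ • v := hv.apply_eq_smul
  have hne : (v : X) ≠ 0 := by simpa using hv.2
  rw [hv', Submodule.coe_smul, map_smul, inner_smul_left, real_inner_self_eq_norm_sq] at h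
  have h1 : 0 < A (v : X) v := (mul_pos hα (pow_pos (norm_pos_iff.2 hne) 2)).trans_le (hA v)
  rw [← h] at h1
  exact pos_of_mul_pos_left h1 (sq_nonneg _)

namespace IsEigenbasis

variable {ι : X →L[ℝ] H} {hι : Function.Injective ι} {A : X →L[ℝ] StrongDual ℝ X}
  {V : Submodule ℝ X} [FiniteDimensional ℝ V] {n : ℕ} {B : Module.Basis (Fin n) ℝ V}
  {lam : Fin n → ℝ}

lemma hasEigenvalue (h : IsEigenbasis ι hι A V B lam) (j : Fin n) :
    (discreteEnd ι hι A V).HasEigenvalue (lam j) :=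
  Module.End.hasEigenvalue_of_hasEigenvector
    (Module.End.hasEigenvector_iff.2 ⟨Module.End.mem_eigenspace_iff.2 (h.apply_eq j), B.ne_zero j⟩)

lemma apply_basis (h : IsEigenbasis ι hι A V B lam) (j : Fin n) (x : V) :
    A (B j : X) x = lam j * ⟪ι (B j : X), ι (x : X)⟫_ℝ := by
  have e := inner_discreteOp ι hι A V (B j) x
  have e' : discreteOp ι hι A V (B j : X) = lam j • B j := h.apply_eq j
  rw [← e, e', Submodule.coe_smul, map_smul, inner_smul_left]
  rfl

lemma inner_sum (h : IsEigenbasis ι hι A V B lam) (c d : Fin n → ℝ) :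
    ⟪ι (∑ j, c j • (B j : X)), ι (∑ j, d j • (B j : X))⟫_ℝ = ∑ j, c j * d j := by
  simp only [map_sum, map_smul]
  rw [h.orthonormal.inner_sum]
  simp

lemma form_sum (h : IsEigenbasis ι hι A V B lam) (c d : Fin n → ℝ) :
    A (∑ j, c j • (B j : X)) (∑ j, d j • (B j : X)) = ∑ j, lam j * (c j * d j) := by
  have hd : (∑ j, d j • (B j : X)) = ((∑ j, d j • B j : V) : X) := by simp
  rw [map_sum A, _root_.sum_apply]
  refine Finset.sum_congr rfl fun j _ => ?_
  rw [map_smul, _root_.smul_apply, hd, h.apply_basis, ← hd]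
  have e := h.inner_sum (Pi.single j 1) d
  simp only [Pi.single_apply, ite_smul, one_smul, zero_smul, Finset.sum_ite_eq', Finset.mem_univ,
    if_true, ite_mul, one_mul, zero_mul] at e
  rw [e, smul_eq_mul]
  ring

lemma norm_sum_sq (h : IsEigenbasis ι hι A V B lam) (c : Fin n → ℝ) :
    ‖ι (∑ j, c j • (B j : X))‖ ^ 2 = ∑ j, c j ^ 2 := by
  rw [← real_inner_self_eq_norm_sq, h.inner_sum]
  simp only [sq]

omit [FiniteDimensional ℝ V] in
lemma mem_polySpace_iff {B : Module.Basis (Fin n) ℝ V} {r : ℕ} {U : ℝ → X} :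
    U ∈ polySpace V r ↔ ∃ p : Fin n → ℝ[X], (∀ j, (p j).natDegree ≤ r) ∧
      U = fun t => ∑ j, (p j).eval t • (B j : X) := by
  constructor
  · rintro ⟨c, hc, hU⟩
    refine ⟨fun j => ∑ i ∈ Finset.range (r + 1), monomial i (B.repr ⟨c i, hc i⟩ j),
      fun j => natDegree_sum_le_of_forall_le _ _ fun i hi =>
        (natDegree_monomial_le _).trans (Nat.lt_succ_iff.1 (Finset.mem_range.1 hi)),
      funext fun t => ?_⟩
    have hci : ∀ i, c i = ∑ j, B.repr ⟨c i, hc i⟩ j • (B j : X) := fun i => by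
      have := congrArg Subtype.val (B.sum_repr ⟨c i, hc i⟩)
      simp only [Submodule.coe_sum, Submodule.coe_smul] at this
      exact this.symm
    rw [hU]
    simp only [eval_finsetSum, eval_monomial, Finset.sum_smul]
    rw [Finset.sum_comm]
    refine Finset.sum_congr rfl fun i _ => ?_
    conv_lhs => rw [hci i]
    rw [Finset.smul_sum]
    refine Finset.sum_congr rfl fun j _ => ?_
    rw [smul_smul, mul_comm]
  · rintro ⟨p, hp, rfl⟩
    refine ⟨fun i => ∑ j, (p j).coeff i • (B j : X),
      fun i => V.sum_mem fun j _ => V.smul_mem _ (B j).2, fun t => ?_⟩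
    simp only [Finset.smul_sum]
    rw [Finset.sum_comm]
    refine Finset.sum_congr rfl fun j _ => ?_
    rw [eval_eq_sum_range' (Nat.lt_succ_of_le (hp j)), Finset.sum_smul]
    refine Finset.sum_congr rfl fun i _ => ?_
    rw [smul_smul, mul_comm]

/-- In an eigenbasis, a dG step decouples into scalar dG steps. -/
lemma isDGStep_iff (h : IsEigenbasis ι hι A V B lam) {r : ℕ} {a b : ℝ} (hab : a < b) {w : H}
    {f : ℝ → H} (hf : MemLp f 2 (volume.restrict (Set.Ioc a b))) {p : Fin n → ℝ[X]} :
    IsDGStep ι A V r a b w f (fun t => ∑ j, (p j).eval t • (B j : X)) ∧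
      (∀ j, (p j).natDegree ≤ r) ↔
    ∀ j, IsScalarStep a b (lam j) r ⟪w, ι (B j : X)⟫_ℝ (fun s => ⟪f s, ι (B j : X)⟫_ℝ) (p j) := by
  have hfj : ∀ j (v : ℝ[X]),
      IntervalIntegrable (fun s => ⟪f s, ι (B j : X)⟫_ℝ * v.eval s) volume a b := fun j v =>
    (intervalIntegrable_iff_integrableOn_Ioc_of_le hab.le).2
      ((hf.inner_const (ι (B j : X))).integrable_mul (memLp_Ioc_of_continuous v.continuous a b))
  have ic : ∀ u v : ℝ[X], IntervalIntegrable (fun s => u.eval s * v.eval s) volume a b :=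
    fun u v => Continuous.intervalIntegrable (by fun_prop) _ _
  have hder : ∀ s, deriv (fun t => ∑ j, (p j).eval t • (B j : X)) s =
      ∑ j, (derivative (p j)).eval s • (B j : X) := fun s =>
    (HasDerivAt.fun_sum fun j _ => ((p j).hasDerivAt s).smul_const (B j : X)).deriv
  have hw : ∀ (x : H) (d : Fin n → ℝ),
      ⟪x, ι (∑ j, d j • (B j : X))⟫_ℝ = ∑ j, ⟪x, ι (B j : X)⟫_ℝ * d j := fun x d => by
    simp only [map_sum, map_smul, _root_.inner_sum, inner_smul_right]
    exact Finset.sum_congr rfl fun j _ => mul_comm _ _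
  -- Both sides of the step equation, expanded in the basis.
  have key : ∀ v : Fin n → ℝ[X],
      ((∫ s in a..b, ⟪ι (deriv (fun t => ∑ j, (p j).eval t • (B j : X)) s),
          ι (∑ j, (v j).eval s • (B j : X))⟫_ℝ)
        + ⟪ι (∑ j, (p j).eval a • (B j : X)) - w, ι (∑ j, (v j).eval a • (B j : X))⟫_ℝ
        + (∫ s in a..b, A (∑ j, (p j).eval s • (B j : X)) (∑ j, (v j).eval s • (B j : X))) =
        ∫ s in a..b, ⟪f s, ι (∑ j, (v j).eval s • (B j : X))⟫_ℝ) ↔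
      (∑ j, ((∫ s in a..b, (derivative (p j)).eval s * (v j).eval s)
        + ((p j).eval a - ⟪w, ι (B j : X)⟫_ℝ) * (v j).eval a
        + lam j * (∫ s in a..b, (p j).eval s * (v j).eval s))) =
        ∑ j, ∫ s in a..b, ⟪f s, ι (B j : X)⟫_ℝ * (v j).eval s := fun v => by
    simp only [hder, inner_sub_left, h.inner_sum, h.form_sum]
    simp only [hw]
    rw [intervalIntegral.integral_finsetSum fun j _ => ic _ _,
      intervalIntegral.integral_finsetSum fun j _ => (ic _ _).const_mul _,
      intervalIntegral.integral_finsetSum fun j _ => hfj _ _, ← Finset.sum_sub_distrib,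
      ← Finset.sum_add_distrib, ← Finset.sum_add_distrib]
    simp only [intervalIntegral.integral_const_mul, sub_mul]
  constructor
  · rintro ⟨hU, hp⟩ j
    refine ⟨hp j, fun q hq => ?_⟩
    have hv : ∀ i, ((Pi.single j q : Fin n → ℝ[X]) i).natDegree ≤ r := fun i => by
      by_cases hij : i = j
      · subst hij; simpa using hq
      · simp [hij]
    have e := (key (Pi.single j q)).1 (hU.2 _ (mem_polySpace_iff.2 ⟨_, hv, rfl⟩))
    rw [Finset.sum_eq_single j (fun i _ hij => by simp [hij]) (by simp),
      Finset.sum_eq_single j (fun i _ hij => by simp [hij]) (by simp)] at e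
    simpa using e
  · intro hs
    refine ⟨⟨mem_polySpace_iff.2 ⟨p, fun j => (hs j).natDegree_le, rfl⟩, fun Φ hΦ => ?_⟩,
      fun j => (hs j).natDegree_le⟩
    obtain ⟨v, hv, rfl⟩ := (mem_polySpace_iff (B := B)).1 hΦ
    exact (key v).2 (Finset.sum_congr rfl fun j _ => (hs j).eq _ (hv j))

end IsEigenbasis

section Estimates

variable {ι : X →L[ℝ] H} (hι : Function.Injective ι) {A : X →L[ℝ] StrongDual ℝ X}
  (hA : ∀ v w : X, A v w = A w v) {α : ℝ} (hα : 0 < α) (hAc : ∀ v : X, α * ‖v‖ ^ 2 ≤ A v v)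
  (V : Submodule ℝ X) [FiniteDimensional ℝ V] {a b : ℝ} (hab : a < b) (r : ℕ)

include hι hA hα hAc hab in
lemma existsUnique_isDGStep (w : H) {f : ℝ → H}
    (hf : MemLp f 2 (volume.restrict (Set.Ioc a b))) : ∃! U, IsDGStep ι A V r a b w f U := by
  obtain ⟨n, B, lam, h⟩ := exists_isEigenbasis ι hι A hA V
  have hlam : ∀ j, 0 < lam j := fun j => eigenvalue_pos hι hα hAc (h.hasEigenvalue j)
  choose p hp using fun j => exists_isScalarStep hab (hlam j) r ⟪w, ι (B j : X)⟫_ℝ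
    (hf.inner_const (ι (B j : X)))
  refine ⟨_, ((h.isDGStep_iff hab hf).2 hp).1, fun U hU => ?_⟩
  obtain ⟨q, hq, rfl⟩ := (IsEigenbasis.mem_polySpace_iff (B := B)).1 hU.1
  have hqs := (h.isDGStep_iff hab hf).1 ⟨hU, hq⟩
  have : q = p := funext fun j => (hqs j).unique hab (hlam j) (hp j)
  rw [this]

lemma bddAbove_scalarConst (ι : X →L[ℝ] H) (hι : Function.Injective ι)
    (A : X →L[ℝ] StrongDual ℝ X) (a b : ℝ) : BddAbove (Set.range fun
      μ : Module.End.Eigenvalues (discreteEnd ι hι A V) => scalarConst a b (μ : ℝ) r) :=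
  Set.Finite.bddAbove (Set.finite_range _)

lemma stepConst_nonneg (ι : X →L[ℝ] H) (hι : Function.Injective ι)
    (A : X →L[ℝ] StrongDual ℝ X) (a b : ℝ) : 0 ≤ stepConst ι hι A V a b r :=
  Real.iSup_nonneg fun _ => zero_le_one.trans (one_le_scalarConst _ _ _ _)

include hα hAc hab in
lemma stepConst_le : stepConst ι hι A V a b r ≤ 1 + 2 * √(3 / (2 * (2 * (r : ℝ) + 1))) :=
  Real.iSup_le (fun μ => scalarConst_le hab (eigenvalue_pos hι hα hAc μ.2) r) (by positivity)

include hA in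
lemma one_le_stepConst (hV : V ≠ ⊥) (a b : ℝ) : 1 ≤ stepConst ι hι A V a b r := by
  obtain ⟨n, B, lam, h⟩ := exists_isEigenbasis ι hι A hA V
  have hn : n ≠ 0 := by
    rintro rfl
    have : Subsingleton V := by
      have := B.repr.toEquiv.subsingleton
      exact this
    exact hV ((Submodule.eq_bot_iff _).2 fun x hx =>
      congrArg Subtype.val (Subsingleton.elim (⟨x, hx⟩ : V) 0))
  exact (one_le_scalarConst a b (lam ⟨0, Nat.pos_of_ne_zero hn⟩) r).trans
    (le_ciSup (bddAbove_scalarConst V r ι hι A a b) ⟨_, h.hasEigenvalue _⟩)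

include hα hAc hab hA in
lemma tendsto_stepConst (hV : V ≠ ⊥) :
    Tendsto (fun n : ℕ => stepConst ι hι A V a b n) atTop (𝓝 1) := by
  refine tendsto_of_tendsto_of_tendsto_of_le_of_le tendsto_const_nhds ?_
    (fun n => one_le_stepConst hι hA V n hV a b) (fun n => stepConst_le hι hα hAc V hab n)
  have h : Tendsto (fun n : ℕ => 3 / (2 * (2 * (n : ℝ) + 1))) atTop (𝓝 0) := by
    refine Tendsto.const_div_atTop ?_ 3
    exact ((tendsto_natCast_atTop_atTop.const_mul_atTop two_pos).atTop_add
      tendsto_const_nhds).const_mul_atTop two_pos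
  simpa using ((h.sqrt).const_mul 2).const_add 1

include hA hα hAc hab in
/-- The stability estimate of one time step: the part of the solution due to the incoming value is
bounded by the fundamental solutions, the part due to the source by `IsScalarStep.abs_eval_le`. -/
lemma norm_isDGStep_le {w : H} {f : ℝ → H} (hf : MemLp f 2 (volume.restrict (Set.Ioc a b)))
    {U : ℝ → X} (hU : IsDGStep ι A V r a b w f U) {t : ℝ} (ht : t ∈ Set.Icc a b) :
    ‖ι (U t)‖ ≤ ‖w‖ + stepConst ι hι A V a b r * √(b - a) * √(∫ s in a..b, ‖f s‖ ^ 2) := by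
  obtain ⟨n, B, lam, h⟩ := exists_isEigenbasis ι hι A hA V
  have hlam : ∀ j, 0 < lam j := fun j => eigenvalue_pos hι hα hAc (h.hasEigenvalue j)
  obtain ⟨p, hp, rfl⟩ := (IsEigenbasis.mem_polySpace_iff (B := B)).1 hU.1
  have hs := (h.isDGStep_iff hab hf).1 ⟨hU, hp⟩
  have hfj := fun j => hf.inner_const (𝕜 := ℝ) (ι (B j : X))
  set K := stepConst ι hι A V a b r with hK
  have hK0 : 0 ≤ K := stepConst_nonneg V r ι hι A a b
  have hf0 : 0 ≤ ∫ s in a..b, ‖f s‖ ^ 2 :=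
    intervalIntegral.integral_nonneg hab.le fun s _ => sq_nonneg _
  have bessel : ∀ x : H, ∑ j, ⟪x, ι (B j : X)⟫_ℝ ^ 2 ≤ ‖x‖ ^ 2 := fun x => by
    have := h.orthonormal.sum_inner_products_le x (s := Finset.univ)
    simpa only [Real.norm_eq_abs, sq_abs, real_inner_comm] using this
  have hdec : (∑ j, (p j).eval t • (B j : X)) =
      (∑ j, (⟪w, ι (B j : X)⟫_ℝ * (fundPoly a b (lam j) r).eval t) • (B j : X)) +
      ∑ j, (p j - C ⟪w, ι (B j : X)⟫_ℝ * fundPoly a b (lam j) r).eval t • (B j : X) := by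
    rw [← Finset.sum_add_distrib]
    refine Finset.sum_congr rfl fun j _ => ?_
    rw [← add_smul, eval_sub, eval_mul, eval_C, add_sub_cancel]
  have h1 : ‖ι (∑ j, (⟪w, ι (B j : X)⟫_ℝ * (fundPoly a b (lam j) r).eval t) • (B j : X))‖ ≤ ‖w‖ := by
    refine (pow_le_pow_iff_left₀ (norm_nonneg _) (norm_nonneg _) two_ne_zero).1 ?_
    rw [h.norm_sum_sq]
    refine le_trans (Finset.sum_le_sum fun j _ => ?_) (bessel w)
    rw [mul_pow]
    refine mul_le_of_le_one_right (sq_nonneg _) ?_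
    rw [sq_le_one_iff_abs_le_one]
    exact abs_fundPoly_le hab (hlam j) r ht
  have h2 : ‖ι (∑ j, (p j - C ⟪w, ι (B j : X)⟫_ℝ * fundPoly a b (lam j) r).eval t • (B j : X))‖ ≤
      K * √(b - a) * √(∫ s in a..b, ‖f s‖ ^ 2) := by
    refine (pow_le_pow_iff_left₀ (norm_nonneg _) (by positivity) two_ne_zero).1 ?_
    rw [h.norm_sum_sq, mul_pow, mul_pow, Real.sq_sqrt (sub_pos.2 hab).le, Real.sq_sqrt hf0]
    have hz : ∀ j, (p j - C ⟪w, ι (B j : X)⟫_ℝ * fundPoly a b (lam j) r).eval t ^ 2 ≤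
        K ^ 2 * (b - a) * ∫ s in a..b, ⟪f s, ι (B j : X)⟫_ℝ ^ 2 := fun j => by
      have hnn : 0 ≤ ∫ s in a..b, ⟪f s, ι (B j : X)⟫_ℝ ^ 2 :=
        intervalIntegral.integral_nonneg hab.le fun s _ => sq_nonneg _
      have hb := ((hs j).sub_fundPoly hab (hlam j)).abs_eval_le hab (hlam j) (hfj j) ht
      have hle : scalarConst a b (lam j) r ≤ K :=
        le_ciSup (bddAbove_scalarConst V r ι hι A a b) ⟨lam j, h.hasEigenvalue j⟩
      have hb' := hb.trans (show _ ≤ K * √(b - a) * √(∫ s in a..b, ⟪f s, ι (B j : X)⟫_ℝ ^ 2) by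
        gcongr)
      rw [← sq_abs]
      refine (pow_le_pow_left₀ (abs_nonneg _) hb' 2).trans_eq ?_
      rw [mul_pow, mul_pow, Real.sq_sqrt (sub_pos.2 hab).le, Real.sq_sqrt hnn]
    refine (Finset.sum_le_sum fun j _ => hz j).trans ?_
    have ij : ∀ j, IntervalIntegrable (fun s => ⟪f s, ι (B j : X)⟫_ℝ ^ 2) volume a b := fun j =>
      (intervalIntegrable_iff_integrableOn_Ioc_of_le hab.le).2 (hfj j).integrable_sq
    rw [← Finset.mul_sum, ← intervalIntegral.integral_finsetSum fun j _ => ij j]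
    refine mul_le_mul_of_nonneg_left ?_ (mul_nonneg (sq_nonneg _) (sub_pos.2 hab).le)
    refine intervalIntegral.integral_mono hab.le
      ((intervalIntegrable_iff_integrableOn_Ioc_of_le hab.le).2
        (integrable_finsetSum _ fun j _ => (hfj j).integrable_sq))
      ((intervalIntegrable_iff_integrableOn_Ioc_of_le hab.le).2 ?_) fun s => bessel (f s)
    exact hf.norm.integrable_sq
  simp only [hdec, map_add]
  exact (norm_add_le _ _).trans (add_le_add h1 h2)

end Estimates

end Step

/-! ### The scheme on the whole time interval -/

lemma toReal_eLpNorm_two {H : Type*} [NormedAddCommGroup H] {f : ℝ → H} {t : ℝ} (ht : 0 ≤ t)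
    (hf : MemLp f 2 (volume.restrict (Set.Ioo 0 t))) :
    (eLpNorm f 2 (volume.restrict (Set.Ioo 0 t))).toReal = √(∫ s in (0 : ℝ)..t, ‖f s‖ ^ 2) := by
  rw [hf.eLpNorm_eq_integral_rpow_norm two_ne_zero ENNReal.ofNat_ne_top,
    ENNReal.toReal_ofReal (by positivity), intervalIntegral.integral_of_le ht,
    integral_Ioc_eq_integral_Ioo, Real.sqrt_eq_rpow]
  simp

lemma sqrt_mul_add_sqrt_mul_le {t k x y : ℝ} (ht : 0 ≤ t) (hk : 0 ≤ k) (hx : 0 ≤ x) (hy : 0 ≤ y) :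
    √t * √x + √k * √y ≤ √(t + k) * √(x + y) := by
  rw [← Real.sqrt_mul (add_nonneg ht hk)]
  refine Real.le_sqrt_of_sq_le ?_
  nlinarith [Real.sq_sqrt ht, Real.sq_sqrt hk, Real.sq_sqrt hx, Real.sq_sqrt hy,
    sq_nonneg (√t * √y - √k * √x), mul_pow (√t) (√x) 2]

section Scheme

variable {X H : Type*} [NormedAddCommGroup X] [InnerProductSpace ℝ X]
  [NormedAddCommGroup H] [InnerProductSpace ℝ H] {T : ℝ} {M : ℕ}

namespace TimePartition

variable (τ : TimePartition T M)

lemma node_lt (i : Fin M) : τ.node i.castSucc < τ.node i.succ :=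
  τ.strictMono Fin.castSucc_lt_succ

lemma node_nonneg (k : Fin (M + 1)) : 0 ≤ τ.node k := by
  rw [← τ.node_zero]
  exact τ.strictMono.monotone (Fin.zero_le k)

lemma node_le (k : Fin (M + 1)) : τ.node k ≤ T := by
  exact (τ.strictMono.monotone (Fin.le_last k)).trans_eq τ.node_last

lemma exists_mem_Ioc (k : Fin (M + 1)) {s : ℝ} (hs : 0 < s) (hk : s ≤ τ.node k) :
    ∃ i : Fin M, i.succ ≤ k ∧ s ∈ Set.Ioc (τ.node i.castSucc) (τ.node i.succ) := by
  induction k using Fin.induction with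
  | zero => rw [τ.node_zero] at hk; linarith
  | succ i ih =>
    rcases le_or_gt s (τ.node i.castSucc) with h | h
    · obtain ⟨j, hj, hjs⟩ := ih h
      exact ⟨j, hj.trans Fin.castSucc_lt_succ.le, hjs⟩
    · exact ⟨i, le_rfl, h, hk⟩

omit [InnerProductSpace ℝ X] in
lemma glue_eq (U : Fin M → ℝ → X) {i : Fin M} {s : ℝ}
    (hs : s ∈ Set.Ioc (τ.node i.castSucc) (τ.node i.succ)) : τ.glue U s = U i s := by
  rw [glue, Finset.sum_eq_single i, Set.indicator_of_mem hs]
  · intro j _ hj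
    refine Set.indicator_of_notMem (fun hjs => ?_) _
    rcases lt_or_gt_of_ne hj with h | h
    · have : τ.node j.succ ≤ τ.node i.castSucc := τ.strictMono.monotone (by
        rw [Fin.le_def]; simpa using h)
      linarith [hs.1, hjs.2]
    · have : τ.node i.succ ≤ τ.node j.castSucc := τ.strictMono.monotone (by
        rw [Fin.le_def]; simpa using h)
      linarith [hs.2, hjs.1]
  · simp

/-- The left limit at a node depends only on the preceding pieces. -/
lemma leftLimit_congr (ι : X →L[ℝ] H) (w₀ : H) {U U' : Fin M → ℝ → X} {i : Fin M}
    (h : ∀ j < i, U j = U' j) :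
    τ.leftLimit ι w₀ U i.castSucc = τ.leftLimit ι w₀ U' i.castSucc := by
  have key : ∀ k : Fin (M + 1), (∀ j : Fin M, j.succ ≤ k → U j = U' j) →
      τ.leftLimit ι w₀ U k = τ.leftLimit ι w₀ U' k := by
    intro k
    refine Fin.cases (fun _ => rfl) (fun j hj => ?_) k
    change ι (U j (τ.node j.succ)) = ι (U' j (τ.node j.succ))
    rw [hj j le_rfl]
  exact key _ fun j hj => h j (by rw [Fin.le_def] at hj; rw [Fin.lt_def]; simpa using hj)

omit [InnerProductSpace ℝ H] in
lemma memLp_step {f : ℝ → H} (hf : MemLp f 2 (volume.restrict (Set.Ioo 0 T))) {j k : Fin (M + 1)} :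
    MemLp f 2 (volume.restrict (Set.Ioc (τ.node j) (τ.node k))) := by
  rw [restrict_Ioo_eq_restrict_Ioc] at hf
  exact hf.mono_measure (Measure.restrict_mono
    (Set.Ioc_subset_Ioc (τ.node_nonneg j) (τ.node_le k)) le_rfl)

end TimePartition

variable {ι : X →L[ℝ] H} (hι : Function.Injective ι) {A : X →L[ℝ] StrongDual ℝ X}
  (hA : ∀ v w : X, A v w = A w v) {α : ℝ} (hα : 0 < α) (hAc : ∀ v : X, α * ‖v‖ ^ 2 ≤ A v v)
  (τ : TimePartition T M) (V : Fin (M + 1) → Submodule ℝ X) [∀ i, FiniteDimensional ℝ (V i)]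

include hι hA hα hAc in
lemma existsUnique_isDGSolution (r : Fin M → ℕ) {f : ℝ → H}
    (hf : MemLp f 2 (volume.restrict (Set.Ioo 0 T))) (u₀ : H) :
    ∃! U : Fin M → ℝ → X, IsDGSolution ι A τ V r f u₀ U := by
  have step := fun (i : Fin M) (w : H) =>
    existsUnique_isDGStep hι hA hα hAc (V i.succ) (τ.node_lt i) (r i) w (τ.memLp_step hf)
  have ex : ∀ k ≤ M, ∃ U : Fin M → ℝ → X, ∀ i : Fin M, (i : ℕ) < k →
      IsDGStep ι A (V i.succ) (r i) (τ.node i.castSucc) (τ.node i.succ)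
        (τ.leftLimit ι (spaceProj ι (V 0) u₀) U i.castSucc) f (U i) := by
    intro k
    induction k with
    | zero => exact fun _ => ⟨0, fun i hi => absurd hi (Nat.not_lt_zero _)⟩
    | succ k ih =>
      intro hk
      obtain ⟨U, hU⟩ := ih (by omega)
      obtain ⟨u, hu, -⟩ := step ⟨k, hk⟩
        (τ.leftLimit ι (spaceProj ι (V 0) u₀) U (Fin.castSucc ⟨k, hk⟩))
      refine ⟨Function.update U ⟨k, hk⟩ u, fun i hi => ?_⟩
      have hleft : τ.leftLimit ι (spaceProj ι (V 0) u₀) (Function.update U ⟨k, hk⟩ u) i.castSucc =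
          τ.leftLimit ι (spaceProj ι (V 0) u₀) U i.castSucc :=
        τ.leftLimit_congr ι _ fun j hj => Function.update_of_ne (by
          rintro rfl
          rw [Fin.lt_def] at hj
          simp only at hj
          omega) _ _
      rw [hleft]
      by_cases hik : i = ⟨k, hk⟩
      · subst hik
        rwa [Function.update_self]
      · rw [Function.update_of_ne hik]
        have : (i : ℕ) ≠ k := fun h => hik (Fin.ext h)
        exact hU i (by omega)
  obtain ⟨U, hU⟩ := ex M le_rfl
  refine ⟨U, fun i => hU i i.2, fun U' hU' => funext fun i => ?_⟩
  induction i using WellFoundedLT.induction with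
  | ind i ih =>
    have h := hU' i
    rw [τ.leftLimit_congr ι _ ih] at h
    exact (step i _).unique h (hU i i.2)

lemma stepConst_le_gammaConst (r : Fin M → ℕ) {i m : Fin M}
    (hi : i ≤ m) : stepConst ι hι A (V i.succ) (τ.node i.castSucc) (τ.node i.succ) (r i) ≤
      gammaConst ι hι A τ V r m := by
  have key : ∀ F : Fin M → ℝ, F i ≤ (Finset.Iic m).sup' Finset.nonempty_Iic F := fun F =>
    Finset.le_sup' F (Finset.mem_Iic.2 hi)
  exact key fun i => stepConst ι hι A (V i.succ) (τ.node i.castSucc) (τ.node i.succ) (r i)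

lemma gammaConst_nonneg (r : Fin M → ℕ) (m : Fin M) : 0 ≤ gammaConst ι hι A τ V r m :=
  (stepConst_nonneg _ _ ι hι A _ _).trans (stepConst_le_gammaConst hι τ V r le_rfl)

include hA hα hAc in
/-- The increments of the single steps are summed with the Cauchy-Schwarz inequality. -/
lemma norm_isDGSolution_le {r : Fin M → ℕ} {f : ℝ → H}
    (hf : MemLp f 2 (volume.restrict (Set.Ioo 0 T))) {u₀ : H} {U : Fin M → ℝ → X}
    (hU : IsDGSolution ι A τ V r f u₀ U) (m i : Fin M) (hi : i ≤ m) {s : ℝ}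
    (hs : s ∈ Set.Icc (τ.node i.castSucc) (τ.node i.succ)) :
    ‖ι (U i s)‖ ≤ ‖spaceProj ι (V 0) u₀‖ + gammaConst ι hι A τ V r m *
      (√(τ.node i.succ) * √(∫ s in (0 : ℝ)..τ.node i.succ, ‖f s‖ ^ 2)) := by
  set w₀ := spaceProj ι (V 0) u₀ with hw₀
  set γ := gammaConst ι hι A τ V r m with hγ
  have hstep : ∀ i ≤ m, stepConst ι hι A (V i.succ) (τ.node i.castSucc) (τ.node i.succ) (r i) ≤ γ :=
    fun i hi => stepConst_le_gammaConst hι τ V r hi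
  have hγ0 : 0 ≤ γ := gammaConst_nonneg hι τ V r m
  have hint : ∀ j k, j ≤ k →
      IntervalIntegrable (fun s => ‖f s‖ ^ 2) volume (τ.node j) (τ.node k) := fun j k hjk => by
    rw [intervalIntegrable_iff_integrableOn_Ioc_of_le (τ.strictMono.monotone hjk)]
    exact (τ.memLp_step hf (j := j) (k := k)).norm.integrable_sq
  have hnn : ∀ j k, j ≤ k → 0 ≤ ∫ s in τ.node j..τ.node k, ‖f s‖ ^ 2 := fun j k hjk =>
    intervalIntegral.integral_nonneg (τ.strictMono.monotone hjk) fun _ _ => sq_nonneg _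
  have hadv : ∀ i ≤ m, ‖τ.leftLimit ι w₀ U i.castSucc‖ ≤ ‖w₀‖ + γ *
        (√(τ.node i.castSucc) * √(∫ s in τ.node 0..τ.node i.castSucc, ‖f s‖ ^ 2)) →
      ∀ s ∈ Set.Icc (τ.node i.castSucc) (τ.node i.succ), ‖ι (U i s)‖ ≤ ‖w₀‖ + γ *
        (√(τ.node i.succ) * √(∫ s in τ.node 0..τ.node i.succ, ‖f s‖ ^ 2)) := by
    intro i hi hleft s hs
    have h := norm_isDGStep_le hι hA hα hAc (V i.succ) (τ.node_lt i) (r i) (τ.memLp_step hf)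
      (hU i) hs
    have hcs := sqrt_mul_add_sqrt_mul_le (τ.node_nonneg i.castSucc)
      (sub_nonneg.2 (τ.node_lt i).le) (hnn 0 i.castSucc (Fin.zero_le _))
      (hnn i.castSucc i.succ Fin.castSucc_lt_succ.le)
    rw [intervalIntegral.integral_add_adjacent_intervals (hint _ _ (Fin.zero_le _))
      (hint _ _ Fin.castSucc_lt_succ.le), add_sub_cancel] at hcs
    have h1 := mul_le_mul_of_nonneg_right (hstep i hi)
      (mul_nonneg (Real.sqrt_nonneg (τ.node i.succ - τ.node i.castSucc))
        (Real.sqrt_nonneg (∫ s in τ.node i.castSucc..τ.node i.succ, ‖f s‖ ^ 2)))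
    have h2 := mul_le_mul_of_nonneg_left hcs hγ0
    rw [mul_assoc] at h
    linarith
  have hnode : ∀ k : Fin (M + 1), k ≤ m.succ → ‖τ.leftLimit ι w₀ U k‖ ≤ ‖w₀‖ + γ *
      (√(τ.node k) * √(∫ s in τ.node 0..τ.node k, ‖f s‖ ^ 2)) := by
    intro k
    induction k using Fin.induction with
    | zero =>
      intro _
      rw [τ.node_zero]
      simp [TimePartition.leftLimit]
    | succ i ih =>
      intro hi
      exact hadv i (Fin.succ_le_succ_iff.1 hi) (ih (Fin.castSucc_lt_succ.le.trans hi)) _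
        (Set.right_mem_Icc.2 (τ.node_lt i).le)
  have h := hadv i hi (hnode i.castSucc
    (Fin.castSucc_lt_succ.le.trans (Fin.succ_le_succ_iff.2 hi))) s hs
  rwa [τ.node_zero] at h

include hA hα hAc in
lemma eLpNorm_isDGSolution_le {r : Fin M → ℕ} {f : ℝ → H}
    (hf : MemLp f 2 (volume.restrict (Set.Ioo 0 T))) {u₀ : H} {U : Fin M → ℝ → X}
    (hU : IsDGSolution ι A τ V r f u₀ U) (m : Fin M) :
    eLpNorm (fun s => ι (τ.glue U s)) ∞ (volume.restrict (Set.Ioo 0 (τ.node m.succ))) ≤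
      ENNReal.ofReal (‖spaceProj ι (V 0) u₀‖ + gammaConst ι hι A τ V r m * √(τ.node m.succ) *
        (eLpNorm f 2 (volume.restrict (Set.Ioo 0 (τ.node m.succ)))).toReal) := by
  have hfm : MemLp f 2 (volume.restrict (Set.Ioo 0 (τ.node m.succ))) :=
    hf.mono_measure (Measure.restrict_mono (Set.Ioo_subset_Ioo le_rfl (τ.node_le _)) le_rfl)
  have hγ0 := gammaConst_nonneg (A := A) hι τ V r m
  rw [toReal_eLpNorm_two (τ.node_nonneg _) hfm, eLpNorm_exponent_top]
  refine eLpNormEssSup_le_of_ae_bound ?_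
  rw [ae_restrict_iff' measurableSet_Ioo]
  refine ae_of_all _ fun s hs => ?_
  obtain ⟨i, him, his⟩ := τ.exists_mem_Ioc m.succ hs.1 hs.2.le
  rw [τ.glue_eq U his]
  refine (norm_isDGSolution_le hι hA hα hAc τ V hf hU m i (Fin.succ_le_succ_iff.1 him)
    (Set.Ioc_subset_Icc_self his)).trans ?_
  have hnode := τ.strictMono.monotone him
  rw [mul_assoc]
  gcongr
  refine intervalIntegral.integral_mono_interval le_rfl (τ.node_nonneg _) hnode
    (ae_of_all _ fun _ => sq_nonneg _) ?_
  have := τ.memLp_step hf (j := 0) (k := m.succ)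
  rw [τ.node_zero] at this
  rw [intervalIntegrable_iff_integrableOn_Ioc_of_le (τ.node_nonneg _)]
  exact this.norm.integrable_sq

include hA hα hAc in
lemma tendsto_gammaConst (m : Fin M) (hV : ∀ i ≤ m, V i.succ ≠ ⊥) :
    Tendsto (fun n : Fin M → ℕ => gammaConst ι hι A τ V n m) atTop (𝓝 1) := by
  have heval : ∀ i : Fin M, Tendsto (fun n : Fin M → ℕ => n i) atTop atTop := fun i =>
    tendsto_atTop.2 fun b => (eventually_ge_atTop fun _ => b).mono fun n hn => hn i
  have hc : ∀ i ∈ Finset.Iic m, Tendsto (fun n : Fin M → ℕ =>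
      stepConst ι hι A (V i.succ) (τ.node i.castSucc) (τ.node i.succ) (n i)) atTop (𝓝 1) :=
    fun i hi => Tendsto.comp (f := fun n : Fin M → ℕ => n i)
      (tendsto_stepConst hι hA hα hAc (V i.succ) (τ.node_lt i) (hV i (Finset.mem_Iic.1 hi)))
      (heval i)
  have h := Tendsto.finset_sup'_nhds_apply Finset.nonempty_Iic hc
  simpa only [Finset.sup'_const, gammaConst] using h

end Scheme

end DGTime

end

theorem mainTheorem1
    {X H : Type*} [NormedAddCommGroup X] [InnerProductSpace ℝ X] [CompleteSpace X]
    [NormedAddCommGroup H] [InnerProductSpace ℝ H] [CompleteSpace H]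
    (ι : X →L[ℝ] H) (hι : Function.Injective ι) (hι_dense : DenseRange ι)
    (A : X →L[ℝ] StrongDual ℝ X) (hA_symm : ∀ v w : X, A v w = A w v)
    (α : ℝ) (hα : 0 < α) (hA_coercive : ∀ v : X, α * ‖v‖ ^ 2 ≤ A v v)
    {T : ℝ} {M : ℕ} (τ : DGTime.TimePartition T M)
    (V : Fin (M + 1) → Submodule ℝ X) [∀ i, FiniteDimensional ℝ (V i)]
    (r : Fin M → ℕ)
    (f : ℝ → H) (hf : MemLp f 2 (volume.restrict (Set.Ioo 0 T))) (u₀ : H) :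
    -- the fully discrete scheme is well posed
    (∃! U : Fin M → ℝ → X, DGTime.IsDGSolution ι A τ V r f u₀ U) ∧
    -- the stability estimate
    (∀ U : Fin M → ℝ → X, DGTime.IsDGSolution ι A τ V r f u₀ U → ∀ m : Fin M,
      eLpNorm (fun s => ι (τ.glue U s)) ∞ (volume.restrict (Set.Ioo 0 (τ.node m.succ))) ≤
        ENNReal.ofReal (‖DGTime.spaceProj ι (V 0) u₀‖ +
          DGTime.gammaConst ι hι A τ V r m * √(τ.node m.succ) *
            (eLpNorm f 2 (volume.restrict (Set.Ioo 0 (τ.node m.succ)))).toReal)) ∧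
    -- bounds on the constants that are uniform in all the data except the degree
    (∀ i : Fin M,
      DGTime.stepConst ι hι A (V i.succ) (τ.node i.castSucc) (τ.node i.succ) (r i) ≤
        1 + 2 * √(3 / (2 * (2 * (r i : ℝ) + 1))) ∧
      (V i.succ ≠ ⊥ →
        1 ≤ DGTime.stepConst ι hι A (V i.succ) (τ.node i.castSucc) (τ.node i.succ) (r i))) ∧
    -- convergence of the constants to 1 as the degrees tend to infinity
    (∀ i : Fin M, V i.succ ≠ ⊥ →
      Tendsto (fun n : ℕ =>
        DGTime.stepConst ι hι A (V i.succ) (τ.node i.castSucc) (τ.node i.succ) n)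
        atTop (𝓝 1)) ∧
    (∀ m : Fin M, (∀ i ≤ m, V i.succ ≠ ⊥) →
      Tendsto (fun n : Fin M → ℕ => DGTime.gammaConst ι hι A τ V n m) atTop (𝓝 1)) := by
  refine ⟨DGTime.existsUnique_isDGSolution hι hA_symm hα hA_coercive τ V r hf u₀,
    fun U hU m => DGTime.eLpNorm_isDGSolution_le hι hA_symm hα hA_coercive τ V hf hU m,
    fun i => ⟨DGTime.stepConst_le hι hα hA_coercive _ (τ.node_lt i) _,
      fun hV => DGTime.one_le_stepConst hι hA_symm _ _ hV _ _⟩,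
    fun i hV => DGTime.tendsto_stepConst hι hA_symm hα hA_coercive _ (τ.node_lt i) hV,
    fun m hV => DGTime.tendsto_gammaConst hι hA_symm hα hA_coercive τ V m hV⟩
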